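/- Let $\mathbb{F}$ be an algebraically closed field of arbitrary characteristic, let $n\ge 0$, and let $A\in M_n(\mathbb{F})$ be a nilpotent matrix that is 2-regular, i.e. each eigenspace of $A$ is at most $2$-dimensional (equivalently, the Jordan canonical form of $A$ has at most two Jordan blocks). Let $$N_2(A)=\{(B,C)\in M_n(\mathbb{F})^2 : AB=BA,\ AC=CA,\ BC=CB,\ B \text{ and } C \text{ nilpotent}\},$$ $$D_2(A)=\{(B,C)\in N_2(A) : \dim_{\mathbb{F}} \mathbb{F}[A,B]=n\},$$ where $\mathbb{F}[A,B]$ is the unital subalgebra of $M_n(\mathbb{F})$ generated by $A$ and $B$. Then the variety $N_2(A)$ is irreducible (as a subset of the affine space $M_n(\mathbb{F})^2\cong\mathbb{F}^{2n^2}$ with the Zariski topology) and, equivalently, $N_2(A)=\overline{D_2(A)}$, where the bar denotes the Zariski closure. -/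

import Mathlib

/-- The Zariski topology on the affine space `F^σ`: the closed sets are the common zero sets of
ideals of polynomials with coefficients in `F`. -/
def zariskiTopology (σ F : Type*) [Field F] : TopologicalSpace (σ → F) :=
  TopologicalSpace.ofClosed {T | ∃ I : Ideal (MvPolynomial σ F), T = MvPolynomial.zeroLocus F I}
    ⟨⊤, by rw [MvPolynomial.zeroLocus_top]; rfl⟩
    (by
      intro 𝒜 h𝒜
      refine ⟨sSup {I | MvPolynomial.zeroLocus F I ∈ 𝒜}, ?_⟩
      ext x
      constructor
      · intro hx
        have hle : sSup {I : Ideal (MvPolynomial σ F) | MvPolynomial.zeroLocus F I ∈ 𝒜} ≤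
            MvPolynomial.vanishingIdeal F {x} := by
          refine sSup_le fun I hI p hp => ?_
          rw [MvPolynomial.mem_vanishingIdeal_singleton_iff]
          exact hx _ hI p hp
        intro p hp
        exact (MvPolynomial.mem_vanishingIdeal_singleton_iff x p).1 (hle hp)
      · intro hx T hT
        obtain ⟨I, rfl⟩ := h𝒜 hT
        exact MvPolynomial.zeroLocus_anti_mono (le_sSup hT) hx)
    (by
      rintro _ ⟨I, rfl⟩ _ ⟨J, rfl⟩
      refine ⟨I ⊓ J, ?_⟩
      ext x
      constructor
      · rintro (hx | hx)
        · exact MvPolynomial.zeroLocus_anti_mono inf_le_left hx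
        · exact MvPolynomial.zeroLocus_anti_mono inf_le_right hx
      · intro hx
        by_contra hcon
        simp only [Set.mem_union, MvPolynomial.mem_zeroLocus_iff, not_or, not_forall] at hcon
        obtain ⟨⟨p, hp, hpx⟩, q, hq, hqx⟩ := hcon
        have h0 := hx (p * q) ⟨I.mul_mem_right _ hp, J.mul_mem_left _ hq⟩
        rw [map_mul] at h0
        exact (mul_ne_zero hpx hqx) h0)

/-- The `2 n ^ 2` entries of a pair of `n × n` matrices. -/
def pairEntries {F : Type*} {n : ℕ} (P : Matrix (Fin n) (Fin n) F × Matrix (Fin n) (Fin n) F) :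
    (Fin n × Fin n) ⊕ (Fin n × Fin n) → F :=
  Sum.elim (fun ij => P.1 ij.1 ij.2) (fun ij => P.2 ij.1 ij.2)

/-- The Zariski topology on pairs of `n × n` matrices, regarded as the affine space
`F^(2 n ^ 2)` by means of the matrix entries. -/
def pairZariski (F : Type*) [Field F] (n : ℕ) :
    TopologicalSpace (Matrix (Fin n) (Fin n) F × Matrix (Fin n) (Fin n) F) :=
  TopologicalSpace.induced pairEntries (zariskiTopology ((Fin n × Fin n) ⊕ (Fin n × Fin n)) F)

/-- A square matrix is `r`-regular if each of its eigenspaces is at most `r`-dimensional. -/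
def IsRegularMatrix {F : Type*} [Field F] {n : ℕ} (r : ℕ) (A : Matrix (Fin n) (Fin n) F) : Prop :=
  ∀ μ : F, Module.finrank F (Module.End.eigenspace (Matrix.toLin' A) μ) ≤ r

/-- `C₂(A)`: the commuting pairs of matrices in the centralizer of `A`. -/
def commutingPairs {F : Type*} [Field F] {n : ℕ} (A : Matrix (Fin n) (Fin n) F) :
    Set (Matrix (Fin n) (Fin n) F × Matrix (Fin n) (Fin n) F) :=
  {P | Commute A P.1 ∧ Commute A P.2 ∧ Commute P.1 P.2}

/-- `N₂(A)`: the commuting pairs of nilpotent matrices in the centralizer of `A`. -/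
def nilpotentPairs {F : Type*} [Field F] {n : ℕ} (A : Matrix (Fin n) (Fin n) F) :
    Set (Matrix (Fin n) (Fin n) F × Matrix (Fin n) (Fin n) F) :=
  {P | P ∈ commutingPairs A ∧ IsNilpotent P.1 ∧ IsNilpotent P.2}

/-- `D₂(A)`: the pairs `(B, C)` in `N₂(A)` such that the unital algebra `F[A, B]` has
dimension `n`. -/
def fullPairs {F : Type*} [Field F] {n : ℕ} (A : Matrix (Fin n) (Fin n) F) :
    Set (Matrix (Fin n) (Fin n) F × Matrix (Fin n) (Fin n) F) :=
  {P | P ∈ nilpotentPairs A ∧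
    Module.finrank F (Algebra.adjoin F ({A, P.1} : Set (Matrix (Fin n) (Fin n) F))) = n}

/-!
Let `A` be nilpotent with at most two Jordan blocks, of sizes `q + e` and `q`. The matrices that
commute with `A` form the endomorphism ring `K` of the `F[X]`-module
`F[X] / X ^ (q + e) × F[X] / X ^ q` on which `X` acts as `A` (`exists_isTwoBlockModel`). As an
`F[X]`-module, `K` is the direct sum of the cyclic modules spanned by `1` and by three elements
`E`, `G`, `H` with annihilator `X ^ q`, so an element of `K` is given by a scalar coordinate `a`
modulo `X ^ (q + e)` and a triple `u` modulo `X ^ q`. Two elements commute if and only if the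
`2 × 2` minors of their triples vanish modulo `X ^ q` (`IsTwoBlockFrame.commute_iff`).
If `q > 0`, nilpotency is the vanishing modulo `X` of the trace and the determinant of the
corresponding `2 × 2` matrix (`IsTwoBlockFrame.isNilpotent_frameElt_iff`).

Call a pair `(B, C)` unimodular if the triple of `B` is nonzero modulo `X` (or `q = 0`). Then
`F[A, B]` has dimension `q + e + q = n` (`IsTwoBlockModel.finrank_adjoin`), and `C = r(A) + s(A) B`
for some polynomials `r` and `s`. Such pairs can be joined by polynomial curves inside the variety,
because the nilpotent elements of `K` can (`IsTwoBlockModel.exists_nilpotent_curve`). Since a set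
in which any two points of a dense subset lie on a polynomial curve is irreducible, and since the
variety is closed and contains `D₂(A)`, which contains the unimodular pairs, both claims follow once
the unimodular pairs are known to be dense (`IsTwoBlockModel.nilpotentPairs_subset_closure`).

For the density the essential case is that both triples are divisible by `X ^ k`, with `0 < k ≤ q`.
If the pair has the form `B = a + X ^ k Z`, `C = r + s B + X ^ (q - k) W` with `W` nilpotent, it is
the limit for `t → 0` of the pairs obtained by replacing `B` by `B + t W`: these commute since
`X ^ q Z` is central, and they are unimodular if `W` is. When `2 k ≤ q` and `k` is maximal, the
vanishing of the minors yields this form, except that `W` need not be nilpotent; but `W` may be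
changed by a linear combination of `Z` and `1`, and for generic `Z` a suitable combination makes
`W` nilpotent, because `F` is algebraically closed. When `2 k > q`, one may take `s = 0` and `W`
divisible by `X`, hence nilpotent.
-/

open Polynomial

/-! ### The Zariski topology on pairs of matrices -/

section Zariski

variable {F : Type*} [Field F] {n : ℕ}

theorem isClosed_pairZariski_iff {Z : Set (Matrix (Fin n) (Fin n) F × Matrix (Fin n) (Fin n) F)} :
    @IsClosed _ (pairZariski F n) Z ↔
      ∃ S : Set (MvPolynomial ((Fin n × Fin n) ⊕ (Fin n × Fin n)) F),
        Z = {P | ∀ p ∈ S, MvPolynomial.aeval (pairEntries P) p = 0} := by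
  let _ := zariskiTopology ((Fin n × Fin n) ⊕ (Fin n × Fin n)) F
  have hcl : ∀ T : Set ((Fin n × Fin n) ⊕ (Fin n × Fin n) → F),
      IsClosed T ↔ ∃ I : Ideal (MvPolynomial _ F), T = MvPolynomial.zeroLocus F I := by
    intro T
    rw [← isOpen_compl_iff]
    change Tᶜᶜ ∈ _ ↔ _
    rw [compl_compl]
    rfl
  refine isClosed_induced_iff.trans ⟨?_, ?_⟩
  · rintro ⟨T, hT, rfl⟩
    obtain ⟨I, rfl⟩ := (hcl T).1 hT
    exact ⟨I, rfl⟩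
  · rintro ⟨S, rfl⟩
    exact ⟨_, (hcl _).2 ⟨Ideal.span S, rfl⟩, by rw [MvPolynomial.zeroLocus_span]; rfl⟩

theorem mem_closure_pairZariski_iff
    {Z : Set (Matrix (Fin n) (Fin n) F × Matrix (Fin n) (Fin n) F)}
    {P : Matrix (Fin n) (Fin n) F × Matrix (Fin n) (Fin n) F} :
    P ∈ @closure _ (pairZariski F n) Z ↔
      ∀ p : MvPolynomial ((Fin n × Fin n) ⊕ (Fin n × Fin n)) F,
        (∀ Q ∈ Z, MvPolynomial.aeval (pairEntries Q) p = 0) →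
          MvPolynomial.aeval (pairEntries P) p = 0 := by
  let _ := pairZariski F n
  constructor
  · intro h p hp
    exact h _ ⟨isClosed_pairZariski_iff.2 ⟨{p}, rfl⟩, fun Q hQ q hq => by
      rw [Set.mem_singleton_iff.1 hq]; exact hp Q hQ⟩ p rfl
  · rintro h T ⟨hT, hZ⟩
    obtain ⟨S, rfl⟩ := isClosed_pairZariski_iff.1 hT
    exact fun p hp => h p fun Q hQ => hZ hQ p hp

/-- A matrix-valued function of one scalar parameter is a polynomial curve if it is obtained by
evaluating a matrix with polynomial entries. -/
def IsPolynomialCurve (f : F → Matrix (Fin n) (Fin n) F) : Prop :=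
  ∃ M : Matrix (Fin n) (Fin n) F[X], ∀ t, f t = (evalRingHom t).mapMatrix M

namespace IsPolynomialCurve

theorem const (B : Matrix (Fin n) (Fin n) F) : IsPolynomialCurve fun _ : F => B :=
  ⟨C.mapMatrix B, fun t => by ext; simp⟩

theorem add {f g : F → Matrix (Fin n) (Fin n) F} (hf : IsPolynomialCurve f)
    (hg : IsPolynomialCurve g) : IsPolynomialCurve fun t => f t + g t := by
  obtain ⟨M, hM⟩ := hf
  obtain ⟨N, hN⟩ := hg
  exact ⟨M + N, fun t => by simp only [map_add, hM, hN]⟩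

theorem mul {f g : F → Matrix (Fin n) (Fin n) F} (hf : IsPolynomialCurve f)
    (hg : IsPolynomialCurve g) : IsPolynomialCurve fun t => f t * g t := by
  obtain ⟨M, hM⟩ := hf
  obtain ⟨N, hN⟩ := hg
  exact ⟨M * N, fun t => by simp only [map_mul, hM, hN]⟩

theorem smul (p : F[X]) {f : F → Matrix (Fin n) (Fin n) F} (hf : IsPolynomialCurve f) :
    IsPolynomialCurve fun t => p.eval t • f t := by
  obtain ⟨M, hM⟩ := hf
  exact ⟨p • M, fun t => by ext; simp [hM]⟩

/-- The pull-back of a polynomial function along a pair of polynomial curves is a polynomial. -/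
theorem exists_eval_eq {f g : F → Matrix (Fin n) (Fin n) F} (hf : IsPolynomialCurve f)
    (hg : IsPolynomialCurve g) (p : MvPolynomial ((Fin n × Fin n) ⊕ (Fin n × Fin n)) F) :
    ∃ r : F[X], ∀ t, r.eval t = MvPolynomial.aeval (pairEntries (f t, g t)) p := by
  obtain ⟨M, hM⟩ := hf
  obtain ⟨N, hN⟩ := hg
  refine ⟨MvPolynomial.aeval (Sum.elim (fun ij => M ij.1 ij.2) fun ij => N ij.1 ij.2) p,
    fun t => ?_⟩
  have h : ((aeval t).comp (MvPolynomial.aeval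
      (Sum.elim (fun ij => M ij.1 ij.2) fun ij => N ij.1 ij.2)) : MvPolynomial _ F →ₐ[F] F) =
      MvPolynomial.aeval (pairEntries (f t, g t)) := by
    ext ij
    rcases ij with ij | ij <;> simp [pairEntries, hM, hN]
  rw [← h, AlgHom.comp_apply, coe_aeval_eq_eval]

theorem mem_closure [Infinite F] {f g : F → Matrix (Fin n) (Fin n) F} (hf : IsPolynomialCurve f)
    (hg : IsPolynomialCurve g)
    {Z : Set (Matrix (Fin n) (Fin n) F × Matrix (Fin n) (Fin n) F)}
    {s : Set F} (hs : s.Finite) (hZ : ∀ t, t ∉ s → (f t, g t) ∈ Z) (t : F) :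
    (f t, g t) ∈ @closure _ (pairZariski F n) Z := by
  rw [mem_closure_pairZariski_iff]
  intro p hp
  obtain ⟨r, hr⟩ := exists_eval_eq hf hg p
  have h0 : r = 0 := Polynomial.eq_zero_of_infinite_isRoot r
    (hs.infinite_compl.mono fun t ht => by
      rw [Set.mem_ofPred_eq, IsRoot.def, hr, hp _ (hZ t ht)])
  rw [← hr, h0, eval_zero]

end IsPolynomialCurve

/-- A set is preirreducible if any two points of some dense subset lie on a polynomial curve
inside the set: two nonzero polynomials in the parameter of the curve have a common non-root. -/
theorem isPreirreducible_pairZariski_of_curves [Infinite F]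
    {N D : Set (Matrix (Fin n) (Fin n) F × Matrix (Fin n) (Fin n) F)}
    (hND : N ⊆ @closure _ (pairZariski F n) D)
    (hcurve : ∀ P ∈ D, ∀ Q ∈ D, ∃ f g : F → Matrix (Fin n) (Fin n) F,
      IsPolynomialCurve f ∧ IsPolynomialCurve g ∧ (∀ t, (f t, g t) ∈ N) ∧
        (f 0, g 0) = P ∧ (f 1, g 1) = Q) :
    @IsPreirreducible _ (pairZariski F n) N := by
  let _ := pairZariski F n
  rw [isPreirreducible_iff_isClosed_union_isClosed]
  intro Z₁ Z₂ h₁ h₂ hsub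
  by_contra hcon
  rw [not_or] at hcon
  have key : ∀ Z : Set (Matrix (Fin n) (Fin n) F × Matrix (Fin n) (Fin n) F),
      IsClosed Z → ¬ N ⊆ Z → ∃ P ∈ D, P ∉ Z := by
    intro Z hZ hN
    by_contra! h
    exact hN (hND.trans (closure_minimal h hZ))
  obtain ⟨P, hP, hP₁⟩ := key Z₁ h₁ hcon.1
  obtain ⟨Q, hQ, hQ₂⟩ := key Z₂ h₂ hcon.2
  obtain ⟨f, g, hf, hg, hN, h0, h1⟩ := hcurve P hP Q hQ
  obtain ⟨S₁, rfl⟩ := isClosed_pairZariski_iff.1 h₁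
  obtain ⟨S₂, rfl⟩ := isClosed_pairZariski_iff.1 h₂
  simp only [Set.mem_ofPred_eq, not_forall] at hP₁ hQ₂
  obtain ⟨p, hp, hpP⟩ := hP₁
  obtain ⟨q, hq, hqQ⟩ := hQ₂
  obtain ⟨r, hr⟩ := IsPolynomialCurve.exists_eval_eq hf hg p
  obtain ⟨s, hs⟩ := IsPolynomialCurve.exists_eval_eq hf hg q
  have hrs : r * s = 0 := Polynomial.funext fun t => by
    rw [eval_mul, eval_zero, hr, hs]
    rcases hsub (hN t) with h | h
    · rw [h p hp, zero_mul]
    · rw [h q hq, mul_zero]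
  rcases mul_eq_zero.1 hrs with h | h
  · rw [← h0, ← hr, h, eval_zero] at hpP
    exact hpP rfl
  · rw [← h1, ← hs, h, eval_zero] at hqQ
    exact hqQ rfl

theorem Matrix.isNilpotent_iff_pow_eq_zero {M : Matrix (Fin n) (Fin n) F} :
    IsNilpotent M ↔ M ^ n = 0 := by
  refine ⟨fun h => ?_, fun h => ⟨n, h⟩⟩
  have h1 := Matrix.isNilpotent_charpoly_sub_pow_of_isNilpotent h
  rw [isNilpotent_iff_eq_zero, sub_eq_zero, Fintype.card_fin] at h1
  have h2 := Matrix.aeval_self_charpoly M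
  rwa [h1, map_pow, aeval_X] at h2

theorem isClosed_nilpotentPairs (A : Matrix (Fin n) (Fin n) F) :
    @IsClosed _ (pairZariski F n) (nilpotentPairs A) := by
  rw [isClosed_pairZariski_iff]
  -- the two generic matrices, and the relations that they have to satisfy
  let U : Matrix (Fin n) (Fin n) (MvPolynomial ((Fin n × Fin n) ⊕ (Fin n × Fin n)) F) :=
    Matrix.of fun i j => MvPolynomial.X (Sum.inl (i, j))
  let V : Matrix (Fin n) (Fin n) (MvPolynomial ((Fin n × Fin n) ⊕ (Fin n × Fin n)) F) :=
    Matrix.of fun i j => MvPolynomial.X (Sum.inr (i, j))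
  let A' : Matrix (Fin n) (Fin n) (MvPolynomial ((Fin n × Fin n) ⊕ (Fin n × Fin n)) F) :=
    MvPolynomial.C.mapMatrix A
  refine ⟨{p | ∃ W ∈ ({A' * U - U * A', A' * V - V * A', U * V - V * U, U ^ n, V ^ n} :
    Set (Matrix (Fin n) (Fin n) _)), ∃ i j, p = W i j}, ?_⟩
  ext ⟨B, C⟩
  let φ := (MvPolynomial.aeval (R := F) (pairEntries (B, C)) : MvPolynomial _ F →ₐ[F] F).toRingHom
  have hU : φ.mapMatrix U = B := by ext; simp [φ, U, pairEntries]
  have hV : φ.mapMatrix V = C := by ext; simp [φ, V, pairEntries]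
  have hA : φ.mapMatrix A' = A := by ext; simp [φ, A']
  have hW : ∀ W : Matrix (Fin n) (Fin n) _,
      (∀ i j, MvPolynomial.aeval (pairEntries (B, C)) (W i j) = 0) ↔ φ.mapMatrix W = 0 := by
    intro W
    rw [← Matrix.ext_iff]
    rfl
  have hall : (∀ p ∈ {p | ∃ W ∈ ({A' * U - U * A', A' * V - V * A', U * V - V * U, U ^ n, V ^ n} :
      Set (Matrix (Fin n) (Fin n) _)), ∃ i j, p = W i j},
        MvPolynomial.aeval (pairEntries (B, C)) p = 0) ↔
      ∀ W ∈ ({A' * U - U * A', A' * V - V * A', U * V - V * U, U ^ n, V ^ n} :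
        Set (Matrix (Fin n) (Fin n) _)), φ.mapMatrix W = 0 := by
    constructor
    · exact fun h W hWm => (hW W).1 fun i j => h _ ⟨W, hWm, i, j, rfl⟩
    · rintro h _ ⟨W, hWm, i, j, rfl⟩
      exact (hW W).2 (h W hWm) i j
  rw [Set.mem_ofPred_eq, hall]
  simp only [Set.mem_insert_iff, Set.mem_singleton_iff, forall_eq_or_imp, forall_eq, map_sub,
    map_mul, map_pow, hU, hV, hA, sub_eq_zero]
  simp only [nilpotentPairs, commutingPairs, Set.mem_ofPred_eq, commute_iff_eq,
    Matrix.isNilpotent_iff_pow_eq_zero, and_assoc]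

end Zariski

/-! ### The endomorphism ring of a module with two Jordan blocks -/

section Frame

variable {F K : Type*} [Field F] [Ring K] [Algebra F[X] K]

/-- `E`, `G`, `H` is a frame of the `F[X]`-algebra `K` if `K` looks like the endomorphism ring of
the module `F[X] / X ^ (q + e) × F[X] / X ^ q`, where `E` is the projection to the second factor,
`G` is the map from the second factor to the first one induced by multiplication by `X ^ e`, and
`H` is the canonical surjection from the first factor to the second one. -/
structure IsTwoBlockFrame (F : Type*) {K : Type*} [Field F] [Ring K] [Algebra F[X] K] (q e : ℕ)
    (E G H : K) : Prop where
  E_mul_E : E * E = E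
  E_mul_G : E * G = 0
  E_mul_H : E * H = H
  G_mul_E : G * E = G
  G_mul_G : G * G = 0
  G_mul_H : G * H = (X ^ e : F[X]) • (1 - E)
  H_mul_E : H * E = 0
  H_mul_G : H * G = (X ^ e : F[X]) • E
  H_mul_H : H * H = 0
  exists_eq : ∀ x : K, ∃ (a : F[X]) (u : Fin 3 → F[X]), x = a • 1 + u 0 • E + u 1 • G + u 2 • H
  eq_zero_iff : ∀ (a : F[X]) (u : Fin 3 → F[X]), a • 1 + u 0 • E + u 1 • G + u 2 • H = 0 ↔
    X ^ (q + e) ∣ a ∧ ∀ i, X ^ q ∣ u i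

/-- The element with coordinates `a` and `u` with respect to `1`, `E`, `G`, `H`. In terms of
`2 × 2` matrices it is `!![a, X ^ e * u 1; u 2, a + u 0]`. -/
def frameElt (E G H : K) (a : F[X]) (u : Fin 3 → F[X]) : K :=
  a • 1 + u 0 • E + u 1 • G + u 2 • H

theorem frameElt_add (E G H : K) (a a' : F[X]) (u u' : Fin 3 → F[X]) :
    frameElt E G H a u + frameElt E G H a' u' = frameElt E G H (a + a') (u + u') := by
  simp only [frameElt, Pi.add_apply]
  module

theorem frameElt_sub (E G H : K) (a a' : F[X]) (u u' : Fin 3 → F[X]) :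
    frameElt E G H a u - frameElt E G H a' u' = frameElt E G H (a - a') (u - u') := by
  simp only [frameElt, Pi.sub_apply]
  module

theorem smul_frameElt (E G H : K) (p a : F[X]) (u : Fin 3 → F[X]) :
    p • frameElt E G H a u = frameElt E G H (p * a) (p • u) := by
  simp only [frameElt, Pi.smul_apply, smul_eq_mul]
  module

theorem frameElt_zero (E G H : K) (a : F[X]) : frameElt E G H a 0 = a • 1 := by
  simp [frameElt]

theorem X_dvd_iff_eval_zero {p : F[X]} : X ∣ p ↔ p.eval 0 = 0 := by
  rw [X_dvd_iff, coeff_zero_eq_eval_zero]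

/-- A triple of polynomials is unimodular modulo `X ^ q` if its only annihilator in
`F[X] / X ^ q` is zero. This holds for every triple if `q = 0`; otherwise it means that some
entry has a nonzero constant term. -/
def IsUnimodularTriple (q : ℕ) (u : Fin 3 → F[X]) : Prop :=
  ∀ g : F[X], (∀ i, X ^ q ∣ g * u i) → X ^ q ∣ g

theorem isCoprime_X_pow {p : F[X]} (hp : p.eval 0 ≠ 0) (m : ℕ) : IsCoprime (X ^ m) p := by
  refine IsCoprime.pow_left ((irreducible_X.coprime_iff_not_dvd).2 ?_)
  rwa [X_dvd_iff_eval_zero]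

theorem isUnimodularTriple_of_eval_ne_zero {u : Fin 3 → F[X]} {i : Fin 3}
    (hi : (u i).eval 0 ≠ 0) (q : ℕ) : IsUnimodularTriple q u := fun _ hg =>
  (isCoprime_X_pow hi q).dvd_of_dvd_mul_right (hg i)

theorem IsUnimodularTriple.exists_eval_ne_zero {q : ℕ} {u : Fin 3 → F[X]}
    (hu : IsUnimodularTriple q u) (hq : 0 < q) : ∃ i, (u i).eval 0 ≠ 0 := by
  by_contra! h
  obtain ⟨m, rfl⟩ := Nat.exists_eq_add_of_lt hq
  rw [zero_add] at hu
  have h1 := hu (X ^ m) fun i => by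
    rw [pow_succ]
    exact mul_dvd_mul_left _ (X_dvd_iff_eval_zero.2 (h i))
  rw [pow_dvd_pow_iff X_ne_zero not_isUnit_X] at h1
  omega

/-- If all `2 × 2` minors of two triples vanish modulo `X ^ m` and the first triple has an
invertible entry, then the second triple is a multiple of the first. -/
theorem exists_multiplier {m : ℕ} {u u' : Fin 3 → F[X]} {i : Fin 3} (hi : (u i).eval 0 ≠ 0)
    (h : ∀ j, X ^ m ∣ u i * u' j - u j * u' i) : ∃ s : F[X], ∀ j, X ^ m ∣ u' j - s * u j := by
  obtain ⟨r, p, hrp⟩ := isCoprime_X_pow hi m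
  refine ⟨p * u' i, fun j => ?_⟩
  have h1 : u' j - p * u' i * u j =
      p * (u i * u' j - u j * u' i) + X ^ m * (r * u' j) := by
    linear_combination (-u' j) * hrp
  rw [h1]
  exact dvd_add ((h j).mul_left p) (dvd_mul_right _ _)

namespace IsTwoBlockFrame

variable {q e : ℕ} {E G H : K} (hK : IsTwoBlockFrame F q e E G H)
include hK

theorem exists_frameElt (x : K) :
    ∃ (a : F[X]) (u : Fin 3 → F[X]), x = frameElt E G H a u :=
  hK.exists_eq x

theorem frameElt_eq_zero_iff {a : F[X]} {u : Fin 3 → F[X]} :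
    frameElt E G H a u = 0 ↔ X ^ (q + e) ∣ a ∧ ∀ i, X ^ q ∣ u i :=
  hK.eq_zero_iff a u

theorem frameElt_congr {a : F[X]} {u u' : Fin 3 → F[X]} (h : ∀ i, X ^ q ∣ u i - u' i) :
    frameElt E G H a u = frameElt E G H a u' := by
  rw [← sub_eq_zero, frameElt_sub, hK.frameElt_eq_zero_iff, sub_self]
  exact ⟨dvd_zero _, h⟩

theorem frameElt_mul (a a' : F[X]) (u u' : Fin 3 → F[X]) :
    frameElt E G H a u * frameElt E G H a' u' =
      frameElt E G H (a * a' + X ^ e * u 1 * u' 2)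
        ![X ^ e * u 2 * u' 1 + (a + u 0) * (a' + u' 0) - (a * a' + X ^ e * u 1 * u' 2),
          a * u' 1 + u 1 * (a' + u' 0), u 2 * a' + (a + u 0) * u' 2] := by
  simp only [frameElt, add_mul, mul_add, smul_mul_assoc, mul_smul_comm, one_mul, mul_one,
    hK.E_mul_E, hK.E_mul_G, hK.E_mul_H, hK.G_mul_E, hK.G_mul_G, hK.G_mul_H, hK.H_mul_E,
    hK.H_mul_G, hK.H_mul_H, Matrix.cons_val]
  module

theorem commute_iff {a a' : F[X]} {u u' : Fin 3 → F[X]} :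
    Commute (frameElt E G H a u) (frameElt E G H a' u') ↔
      ∀ i j, X ^ q ∣ u i * u' j - u j * u' i := by
  rw [commute_iff_eq, ← sub_eq_zero, hK.frameElt_mul, hK.frameElt_mul, frameElt_sub,
    hK.frameElt_eq_zero_iff]
  have ha : a * a' + X ^ e * u 1 * u' 2 - (a' * a + X ^ e * u' 1 * u 2) =
      X ^ e * (u 1 * u' 2 - u 2 * u' 1) := by ring
  have h0 : X ^ e * u 2 * u' 1 + (a + u 0) * (a' + u' 0) - (a * a' + X ^ e * u 1 * u' 2) -
      (X ^ e * u' 2 * u 1 + (a' + u' 0) * (a + u 0) - (a' * a + X ^ e * u' 1 * u 2)) =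
      (-2 * X ^ e) * (u 1 * u' 2 - u 2 * u' 1) := by ring
  have h1 : a * u' 1 + u 1 * (a' + u' 0) - (a' * u 1 + u' 1 * (a + u 0)) =
      -(u 0 * u' 1 - u 1 * u' 0) := by ring
  have h2 : u 2 * a' + (a + u 0) * u' 2 - (u' 2 * a + (a' + u' 0) * u 2) =
      u 0 * u' 2 - u 2 * u' 0 := by ring
  simp only [Fin.forall_fin_succ, Fin.isValue, Pi.sub_apply, Matrix.cons_val, Fin.succ_zero_eq_one,
    Fin.succ_one_eq_two, IsEmpty.forall_iff, and_true, ha, h0, h1, h2]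
  constructor
  · rintro ⟨h12, -, h01, h02⟩
    rw [dvd_neg] at h01
    rw [add_comm q e, pow_add, mul_dvd_mul_iff_left (pow_ne_zero _ X_ne_zero)] at h12
    have hs : ∀ i j, X ^ q ∣ u i * u' j - u j * u' i → X ^ q ∣ u j * u' i - u i * u' j :=
      fun i j h => by rw [← neg_sub, dvd_neg]; exact h
    simp only [sub_self, dvd_zero, true_and, and_true]
    exact ⟨⟨h01, h02⟩, ⟨hs _ _ h01, h12⟩, hs _ _ h02, hs _ _ h12⟩
  · rintro ⟨⟨-, h01, h02⟩, ⟨-, -, h12⟩, -⟩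
    refine ⟨?_, h12.mul_left _, (dvd_neg).2 h01, h02⟩
    rw [add_comm q e, pow_add]
    exact mul_dvd_mul_left _ h12

theorem X_pow_smul_commute (x y : K) : Commute ((X ^ q : F[X]) • x) y := by
  obtain ⟨a, u, rfl⟩ := hK.exists_frameElt x
  obtain ⟨a', u', rfl⟩ := hK.exists_frameElt y
  rw [smul_frameElt, hK.commute_iff]
  intro i j
  refine dvd_sub ?_ ?_ <;> simp only [Pi.smul_apply, smul_eq_mul, mul_assoc] <;>
    exact dvd_mul_right _ _

theorem isNilpotent_X_smul (x : K) : IsNilpotent ((X : F[X]) • x) := by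
  refine ⟨q + e, ?_⟩
  have h : (X ^ (q + e) : F[X]) • (1 : K) = 0 := by
    rw [← frameElt_zero E G H, hK.frameElt_eq_zero_iff]
    exact ⟨dvd_rfl, fun i => dvd_zero _⟩
  rw [_root_.smul_pow, ← one_mul (x ^ (q + e)), ← smul_mul_assoc, h, zero_mul]

theorem isNilpotent_smul_of_eval_eq_zero {p : F[X]} (hp : p.eval 0 = 0) (x : K) :
    IsNilpotent (p • x) := by
  obtain ⟨p, rfl⟩ := X_dvd_iff_eval_zero.2 hp
  rw [mul_smul]
  exact hK.isNilpotent_X_smul _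

theorem eq_zero_of_isNilpotent_C (hq : 0 < q) {c : F} (h : IsNilpotent (C c • (1 : K))) :
    c = 0 := by
  obtain ⟨m, hm⟩ := h
  rw [_root_.smul_pow, one_pow, ← frameElt_zero E G H, hK.frameElt_eq_zero_iff, ← C_pow] at hm
  have h1 := (dvd_pow_self X (by omega : q + e ≠ 0)).trans hm.1
  rw [X_dvd_iff_eval_zero, eval_C] at h1
  exact eq_zero_of_pow_eq_zero h1

end IsTwoBlockFrame

end Frame

/-! ### Nilpotent elements of the endomorphism ring -/

section Nilpotent

variable {F K : Type*} [Field F] [Ring K] [Algebra F[X] K]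

theorem exists_eq_C_add_X_mul (p : F[X]) : ∃ r : F[X], p = C (p.eval 0) + X * r := by
  obtain ⟨r, hr⟩ : X ∣ p - C (p.eval 0) := by
    rw [X_dvd_iff_eval_zero, eval_sub, eval_C, sub_self]
  exact ⟨r, by rw [← hr]; ring⟩

namespace IsTwoBlockFrame

variable {q e : ℕ} {E G H : K} (hK : IsTwoBlockFrame F q e E G H)
include hK

/-- The Cayley–Hamilton relation for the `2 × 2` matrix of `frameElt E G H a u`. -/
theorem frameElt_mul_self (a : F[X]) (u : Fin 3 → F[X]) :
    frameElt E G H a u * frameElt E G H a u =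
      (2 * a + u 0) • frameElt E G H a u - (a * (a + u 0) - X ^ e * u 1 * u 2) • 1 := by
  rw [hK.frameElt_mul, smul_frameElt, ← frameElt_zero E G H, frameElt_sub]
  congr 1
  · ring
  · ext1 i
    fin_cases i <;> simp <;> ring

/-- If the trace or the determinant of the matrix of a nilpotent element were nonzero modulo `X`,
the Cayley–Hamilton relation would make the element, or a nonzero scalar, divisible by `X`. -/
theorem eval_eq_zero_of_isNilpotent (hq : 0 < q) {a : F[X]} {u : Fin 3 → F[X]}
    (h : IsNilpotent (frameElt E G H a u)) :
    (2 * a + u 0).eval 0 = 0 ∧ (a * (a + u 0) - X ^ e * u 1 * u 2).eval 0 = 0 := by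
  have hCH := hK.frameElt_mul_self a u
  obtain ⟨x, hx⟩ : ∃ x, x = frameElt E G H a u := ⟨_, rfl⟩
  rw [← hx] at h hCH
  by_cases hu : ∀ i, (u i).eval 0 = 0
  · -- in this case `x` is a scalar plus a multiple of `X`
    have hX : ∀ i, ∃ v, u i = X * v := fun i => X_dvd_iff_eval_zero.2 (hu i)
    choose v hv using hX
    obtain ⟨b, hb⟩ := exists_eq_C_add_X_mul a
    have h1 : C (a.eval 0) • (1 : K) = x - (X : F[X]) • frameElt E G H b v := by
      rw [hx, smul_frameElt, frameElt_sub, ← frameElt_zero E G H]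
      congr 1
      · linear_combination -hb
      · ext1 i
        simp [hv]
    have hc : Commute x ((X : F[X]) • frameElt E G H b v) := by
      have h2 : (X : F[X]) • frameElt E G H b v = x - C (a.eval 0) • 1 := by rw [h1]; abel
      rw [h2]
      exact (Commute.refl x).sub_right ((Commute.one_right x).smul_right _)
    have ha : a.eval 0 = 0 := hK.eq_zero_of_isNilpotent_C hq (by
      rw [h1]
      exact hc.isNilpotent_sub h (hK.isNilpotent_X_smul _))
    simp [ha, hu]
  · push Not at hu
    obtain ⟨i, hi⟩ := hu
    obtain ⟨t, ht⟩ := exists_eq_C_add_X_mul (2 * a + u 0)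
    obtain ⟨d, hd⟩ := exists_eq_C_add_X_mul (a * (a + u 0) - X ^ e * u 1 * u 2)
    set t0 := (2 * a + u 0).eval 0
    set d0 := (a * (a + u 0) - X ^ e * u 1 * u 2).eval 0
    have hcw : Commute x (t • x - d • 1) :=
      ((Commute.refl x).smul_right _).sub_right ((Commute.one_right x).smul_right _)
    have hd0 : d0 = 0 := hK.eq_zero_of_isNilpotent_C hq (by
      have h1 : C d0 • (1 : K) = (C t0 • x - x * x) + (X : F[X]) • (t • x - d • 1) := by
        rw [hCH, ht, hd]
        module
      rw [h1]
      have h2 : Commute x (C t0 • x - x * x) :=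
        ((Commute.refl x).smul_right _).sub_right ((Commute.refl x).mul_right (Commute.refl x))
      refine Commute.isNilpotent_add ?_ ?_ (hK.isNilpotent_X_smul _)
      · refine Commute.smul_right ?_ _
        exact (hcw.smul_left _).sub_left (hcw.mul_left hcw)
      · have h3 : C t0 • x - x * x = x * (C t0 • 1 - x) := by
          rw [mul_sub, mul_smul_comm, mul_one]
        rw [h3]
        exact Commute.isNilpotent_mul_right
          (((Commute.one_right x).smul_right _).sub_right (Commute.refl x)) h)
    refine ⟨?_, hd0⟩
    by_contra ht0
    -- now `x` times the unit `C t0 • 1 - x` is divisible by `X`, hence so is `x`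
    have hunit : IsUnit (x - C t0 • 1) := by
      have h1 : IsUnit (-(C t0 • (1 : K))) := by
        refine IsUnit.neg ⟨⟨C t0 • 1, C t0⁻¹ • 1, ?_, ?_⟩, rfl⟩ <;>
          rw [smul_mul_smul_comm, one_mul, ← C_mul] <;> simp [ht0]
      rw [sub_eq_add_neg, add_comm]
      exact h.isUnit_add_left_of_commute h1 (((Commute.one_right x).smul_right _).neg_right)
    obtain ⟨y, hy⟩ := hunit.exists_left_inv
    obtain ⟨b, v, hbv⟩ := hK.exists_frameElt (y * (t • x - d • 1))
    have h1 : x = (X : F[X]) • frameElt E G H b v := by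
      rw [← hbv, ← mul_smul_comm]
      have h2 : (X : F[X]) • (t • x - d • 1) = (x - C t0 • 1) * x := by
        rw [sub_mul, hCH, ht, hd, hd0, smul_mul_assoc, one_mul, C_0]
        module
      rw [h2, ← mul_assoc, hy, one_mul]
    rw [hx, smul_frameElt, ← sub_eq_zero, frameElt_sub, hK.frameElt_eq_zero_iff] at h1
    have h2 := (dvd_pow_self X hq.ne').trans (h1.2 i)
    rw [X_dvd_iff_eval_zero] at h2
    simp [hi] at h2

theorem isNilpotent_frameElt_iff (hq : 0 < q) {a : F[X]} {u : Fin 3 → F[X]} :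
    IsNilpotent (frameElt E G H a u) ↔
      (2 * a + u 0).eval 0 = 0 ∧ (a * (a + u 0) - X ^ e * u 1 * u 2).eval 0 = 0 := by
  refine ⟨hK.eval_eq_zero_of_isNilpotent hq, fun ⟨ht, hd⟩ => ?_⟩
  obtain ⟨t, ht⟩ := X_dvd_iff_eval_zero.2 ht
  obtain ⟨d, hd⟩ := X_dvd_iff_eval_zero.2 hd
  have h1 := hK.frameElt_mul_self a u
  rw [ht, hd, mul_smul, mul_smul, ← smul_sub] at h1
  have h2 := hK.isNilpotent_X_smul (t • frameElt E G H a u - d • 1)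
  rw [← h1, ← pow_two] at h2
  exact (IsNilpotent.pow_iff_pos two_ne_zero).1 h2

end IsTwoBlockFrame

end Nilpotent

/-! ### Deformation of commuting nilpotent pairs -/

section Model

variable {F K : Type*} [Field F] [Ring K] [Algebra F[X] K] {n : ℕ}

/-- An embedding `ρ` of an `F[X]`-algebra `K` with frame `E`, `G`, `H` into the matrices, which
identifies `K` with the centralizer of `A` in such a way that `X` acts as `A`. -/
structure IsTwoBlockModel (A : Matrix (Fin n) (Fin n) F) (q e : ℕ) (E G H : K)
    (ρ : K →+* Matrix (Fin n) (Fin n) F) : Prop extends IsTwoBlockFrame F q e E G H where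
  injective : Function.Injective ρ
  map_smul : ∀ (p : F[X]) (x : K), ρ (p • x) = aeval A p * ρ x
  exists_eq_of_commute : ∀ B : Matrix (Fin n) (Fin n) F, Commute A B → ∃ x, B = ρ x
  size_eq : q + e + q = n

/-- The commuting nilpotent pairs whose first component has unimodular coordinates modulo the
scalars. -/
def unimodularPairs (A : Matrix (Fin n) (Fin n) F) (q : ℕ) (E G H : K)
    (ρ : K →+* Matrix (Fin n) (Fin n) F) :
    Set (Matrix (Fin n) (Fin n) F × Matrix (Fin n) (Fin n) F) :=
  {P | P ∈ nilpotentPairs A ∧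
    ∃ (a : F[X]) (u : Fin 3 → F[X]), IsUnimodularTriple q u ∧ P.1 = ρ (frameElt E G H a u)}

theorem quadratic_ne_zero {a b c : F} (ha : a ≠ 0) : C a * X ^ 2 + C b * X + C c ≠ 0 := by
  intro h
  have := degree_quadratic (b := b) (c := c) ha
  rw [h] at this
  simp at this

theorem exists_quadratic_root [IsAlgClosed F] {a : F} (ha : a ≠ 0) (b c : F) :
    ∃ x, a * x ^ 2 + b * x + c = 0 := by
  obtain ⟨x, hx⟩ := IsAlgClosed.exists_root (C a * X ^ 2 + C b * X + C c)
    (by rw [degree_quadratic ha]; decide)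
  exact ⟨x, by simpa using hx⟩

namespace IsTwoBlockModel

variable {A : Matrix (Fin n) (Fin n) F} {q e : ℕ} {E G H : K}
  {ρ : K →+* Matrix (Fin n) (Fin n) F} (hM : IsTwoBlockModel A q e E G H ρ)
include hM

theorem map_C_smul (t : F) (x : K) : ρ (C t • x) = t • ρ x := by
  rw [hM.map_smul, aeval_C, Algebra.algebraMap_eq_smul_one, smul_mul_assoc, one_mul]

theorem commute_map (x : K) : Commute A (ρ x) := by
  have h1 := hM.map_smul X 1
  rw [aeval_X, map_one, mul_one] at h1
  rw [← h1]
  refine Commute.map (f := ρ) ?_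
  exact (Commute.one_left x).smul_left _

theorem map_mem_nilpotentPairs_iff {x y : K} :
    (ρ x, ρ y) ∈ nilpotentPairs A ↔ Commute x y ∧ IsNilpotent x ∧ IsNilpotent y := by
  have h1 : Commute (ρ x) (ρ y) ↔ Commute x y := by
    rw [commute_iff_eq, commute_iff_eq, ← map_mul, ← map_mul, hM.injective.eq_iff]
  simp only [nilpotentPairs, commutingPairs, Set.mem_ofPred_eq, hM.commute_map, true_and, h1,
    IsNilpotent.map_iff hM.injective]

theorem isPolynomialCurve_line (x y : K) : IsPolynomialCurve fun t : F => ρ (x + C t • y) := by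
  have h := (IsPolynomialCurve.const (ρ x)).add ((IsPolynomialCurve.const (ρ y)).smul X)
  simpa only [map_add, hM.map_C_smul, eval_X] using h

theorem mem_closure_of_line [Infinite F]
    {Z : Set (Matrix (Fin n) (Fin n) F × Matrix (Fin n) (Fin n) F)} {x x' y y' : K}
    {s : Set F} (hs : s.Finite) (h : ∀ t, t ∉ s →
      (ρ (x + C t • x'), ρ (y + C t • y')) ∈ @closure _ (pairZariski F n) Z) :
    (ρ x, ρ y) ∈ @closure _ (pairZariski F n) Z := by
  let _ := pairZariski F n
  have h1 := (hM.isPolynomialCurve_line x x').mem_closure (hM.isPolynomialCurve_line y y') hs h 0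
  rw [closure_closure] at h1
  simpa using h1

/-- The basic deformation: since `X ^ q • K` is central, `X ^ (q - k) • W` commutes with
`a • 1 + X ^ k • Z + C t • W` for every `t`. -/
theorem mem_closure_of_unimodular [Infinite F] {k : ℕ} (hk : 0 < k) (hkq : k ≤ q) {a r s : F[X]}
    {Z W : K} (ha : a.eval 0 = 0) (hr : r.eval 0 = 0) (hW : IsNilpotent W)
    (hu : ∃ (b : F[X]) (u : Fin 3 → F[X]), IsUnimodularTriple q u ∧ W = frameElt E G H b u) :
    (ρ (a • 1 + (X ^ k : F[X]) • Z),
      ρ (r • 1 + s • (a • 1 + (X ^ k : F[X]) • Z) + (X ^ (q - k) : F[X]) • W)) ∈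
        @closure _ (pairZariski F n) (unimodularPairs A q E G H ρ) := by
  have hq : 0 < q := hk.trans_le hkq
  obtain ⟨b, w, hw, rfl⟩ := hu
  obtain ⟨i, hi⟩ := hw.exists_eval_ne_zero hq
  obtain ⟨z0, z, rfl⟩ := hM.exists_frameElt Z
  set W := frameElt E G H b w with hWdef
  refine hM.mem_closure_of_line (Set.finite_singleton (0 : F)) (x' := W) (y' := s • W)
    fun t ht => ?_
  rw [Set.mem_singleton_iff] at ht
  have hx : a • 1 + (X ^ k : F[X]) • frameElt E G H z0 z + C t • W =
      frameElt E G H (a + X ^ k * z0 + C t * b) ((X ^ k : F[X]) • z + C t • w) := by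
    rw [← frameElt_zero E G H, smul_frameElt, frameElt_add, smul_frameElt, frameElt_add, zero_add]
  have hxn : IsNilpotent (a • 1 + (X ^ k : F[X]) • frameElt E G H z0 z + C t • W) := by
    obtain ⟨h1, h2⟩ := (hM.isNilpotent_frameElt_iff hq).1 hW
    rw [hx, hM.isNilpotent_frameElt_iff hq]
    simp only [eval_add, eval_mul, eval_sub, eval_pow, eval_X, Pi.add_apply, Pi.smul_apply,
      smul_eq_mul, eval_C, ha, zero_pow hk.ne', eval_ofNat] at h1 h2 ⊢
    exact ⟨by linear_combination t * h1, by linear_combination t ^ 2 * h2⟩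
  have hcomm : Commute (a • 1 + (X ^ k : F[X]) • frameElt E G H z0 z + C t • W)
      ((X ^ (q - k) : F[X]) • W) := by
    refine (((Commute.one_left W).smul_left _).smul_right _ |>.add_left ?_).add_left
      (((Commute.refl W).smul_left _).smul_right _)
    have h1 := hM.X_pow_smul_commute (frameElt E G H z0 z) W
    rw [commute_iff_eq, smul_mul_assoc, mul_smul_comm] at h1
    rw [commute_iff_eq, smul_mul_smul_comm, smul_mul_smul_comm, ← pow_add, ← pow_add,
      Nat.sub_add_cancel hkq, Nat.add_sub_cancel' hkq, h1]
  have hy : r • 1 + s • (a • 1 + (X ^ k : F[X]) • frameElt E G H z0 z) +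
      (X ^ (q - k) : F[X]) • W + C t • s • W =
      r • 1 + s • (a • 1 + (X ^ k : F[X]) • frameElt E G H z0 z + C t • W) +
        (X ^ (q - k) : F[X]) • W := by module
  refine @subset_closure _ (pairZariski F n) _ _ ⟨?_, _, _, ?_, congrArg ρ hx⟩
  · rw [hy, hM.map_mem_nilpotentPairs_iff]
    set x := a • 1 + (X ^ k : F[X]) • frameElt E G H z0 z + C t • W
    refine ⟨(((Commute.one_right x).smul_right _).add_right
      ((Commute.refl x).smul_right _)).add_right hcomm, hxn, ?_⟩
    have hsx : IsNilpotent (s • x) := hxn.smul _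
    refine Commute.isNilpotent_add ?_ (Commute.isNilpotent_add ?_
      (hM.isNilpotent_smul_of_eval_eq_zero hr _) hsx) (hW.smul _)
    · exact ((Commute.one_left _).smul_left _).add_left (hcomm.smul_left _)
    · exact (Commute.one_left _).smul_left _
  · refine isUnimodularTriple_of_eval_ne_zero (i := i) ?_ q
    simp [hk.ne', ht, hi]

/-- The unimodularity of `W` in the basic deformation is not needed: if it fails, then `W + C t • G`
is nilpotent and unimodular for `t ≠ 0`. -/
theorem mem_closure_of_isNilpotent [Infinite F] {k : ℕ} (hk : 0 < k) (hkq : k ≤ q)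
    {a r s : F[X]} {Z W : K} (ha : a.eval 0 = 0) (hr : r.eval 0 = 0) (hW : IsNilpotent W) :
    (ρ (a • 1 + (X ^ k : F[X]) • Z),
      ρ (r • 1 + s • (a • 1 + (X ^ k : F[X]) • Z) + (X ^ (q - k) : F[X]) • W)) ∈
        @closure _ (pairZariski F n) (unimodularPairs A q E G H ρ) := by
  have hq : 0 < q := hk.trans_le hkq
  obtain ⟨b, w, hbw⟩ := hM.exists_frameElt W
  by_cases hw : ∃ i, (w i).eval 0 ≠ 0
  · obtain ⟨i, hi⟩ := hw
    exact hM.mem_closure_of_unimodular hk hkq ha hr hW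
      ⟨b, w, isUnimodularTriple_of_eval_ne_zero hi q, hbw⟩
  · push Not at hw
    rw [hbw, hM.isNilpotent_frameElt_iff hq] at hW
    simp only [eval_add, eval_mul, eval_sub, eval_ofNat, hw, add_zero, mul_zero, sub_zero] at hW
    refine hM.mem_closure_of_line (Set.finite_singleton (0 : F)) (x' := 0)
      (y' := (X ^ (q - k) : F[X]) • G) fun t ht => ?_
    rw [Set.mem_singleton_iff] at ht
    have hy : r • 1 + s • (a • 1 + (X ^ k : F[X]) • Z) + (X ^ (q - k) : F[X]) • W +
        C t • (X ^ (q - k) : F[X]) • G = r • 1 + s • (a • 1 + (X ^ k : F[X]) • Z) +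
        (X ^ (q - k) : F[X]) • (W + C t • G) := by module
    have hW' : W + C t • G = frameElt E G H b (w + ![0, C t, 0]) := by
      rw [hbw]
      simp only [frameElt, Pi.add_apply, Matrix.cons_val]
      module
    rw [hy, smul_zero, add_zero, hW']
    refine hM.mem_closure_of_unimodular hk hkq ha hr ?_ ⟨b, _, ?_, rfl⟩
    · rw [hM.isNilpotent_frameElt_iff hq]
      simp [hw, hW]
    · refine isUnimodularTriple_of_eval_ne_zero (i := 1) ?_ q
      simp [hw, ht]

/-- If the discriminant of the matrix of `Z` does not vanish modulo `X`, then every `W` is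
nilpotent up to a linear combination of `Z` and `1`: make first the discriminant vanish, by
solving a quadratic equation, and then the trace. -/
theorem exists_isNilpotent_add [IsAlgClosed F] (hq : 0 < q) {z0 : F[X]} {z : Fin 3 → F[X]}
    (hz : (z 0 ^ 2 + 4 * (X ^ e * z 1 * z 2)).eval 0 ≠ 0) (W : K) :
    ∃ c d : F, IsNilpotent (W + C c • frameElt E G H z0 z + C d • 1) := by
  obtain ⟨b, w, rfl⟩ := hM.exists_frameElt W
  simp only [eval_add, eval_mul, eval_pow, eval_X, eval_ofNat] at hz
  obtain ⟨c, hc⟩ := exists_quadratic_root hz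
    (2 * (w 0).eval 0 * (z 0).eval 0 +
      4 * 0 ^ e * ((w 1).eval 0 * (z 2).eval 0 + (z 1).eval 0 * (w 2).eval 0))
    ((w 0).eval 0 ^ 2 + 4 * (0 ^ e * (w 1).eval 0 * (w 2).eval 0))
  obtain ⟨y, hy⟩ := exists_quadratic_root (one_ne_zero (α := F))
    ((w 0).eval 0 + c * (z 0).eval 0)
    (-(0 ^ e * ((w 1).eval 0 + c * (z 1).eval 0) * ((w 2).eval 0 + c * (z 2).eval 0)))
  refine ⟨c, y - b.eval 0 - c * z0.eval 0, ?_⟩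
  rw [← frameElt_zero E G H, smul_frameElt, frameElt_add, frameElt_add,
    hM.isNilpotent_frameElt_iff hq]
  simp only [eval_add, eval_mul, eval_sub, eval_pow, eval_X, Pi.add_apply, Pi.smul_apply,
    smul_eq_mul, eval_C, eval_ofNat, Pi.zero_apply, add_zero]
  constructor
  · refine eq_zero_of_pow_eq_zero (n := 2) ?_
    linear_combination 4 * hy + hc
  · linear_combination hy

/-- For `2 * k ≤ q` the nilpotency of `W` is not needed either: adding multiples of `Z` and of `1`
to `W` amounts to changing `s` and `r`. -/
theorem mem_closure_of_discrim_ne_zero [IsAlgClosed F] {k : ℕ} (hk : 0 < k) (hkq : 2 * k ≤ q)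
    {a r s z0 : F[X]} {z : Fin 3 → F[X]} {W : K} (ha : a.eval 0 = 0) (hr : r.eval 0 = 0)
    (hz : (z 0 ^ 2 + 4 * (X ^ e * z 1 * z 2)).eval 0 ≠ 0) :
    (ρ (a • 1 + (X ^ k : F[X]) • frameElt E G H z0 z),
      ρ (r • 1 + s • (a • 1 + (X ^ k : F[X]) • frameElt E G H z0 z) +
        (X ^ (q - k) : F[X]) • W)) ∈
        @closure _ (pairZariski F n) (unimodularPairs A q E G H ρ) := by
  have : Infinite F := IsAlgClosed.instInfinite
  obtain ⟨c, d, hcd⟩ := hM.exists_isNilpotent_add (by omega) (z0 := z0) hz W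
  have hpow : (X ^ (q - k) : F[X]) = X ^ (q - 2 * k) * X ^ k := by
    rw [← pow_add]
    congr 1
    omega
  have h1 := hM.mem_closure_of_isNilpotent hk (by omega) (Z := frameElt E G H z0 z)
    (r := r - C d * X ^ (q - k) + C c * X ^ (q - 2 * k) * a) (s := s - C c * X ^ (q - 2 * k))
    ha ?_ hcd
  · convert h1 using 3
    rw [hpow]
    module
  · have hqk : q - k ≠ 0 := by omega
    simp [hr, ha, zero_pow hqk]

/-- The discriminant of `Z` becomes nonzero when a generic multiple of `E` is added to `Z`. -/
theorem mem_closure_of_two_mul_le [IsAlgClosed F] {k : ℕ} (hk : 0 < k) (hkq : 2 * k ≤ q)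
    {a r s : F[X]} {Z W : K} (ha : a.eval 0 = 0) (hr : r.eval 0 = 0) :
    (ρ (a • 1 + (X ^ k : F[X]) • Z),
      ρ (r • 1 + s • (a • 1 + (X ^ k : F[X]) • Z) + (X ^ (q - k) : F[X]) • W)) ∈
        @closure _ (pairZariski F n) (unimodularPairs A q E G H ρ) := by
  have : Infinite F := IsAlgClosed.instInfinite
  obtain ⟨z0, z, rfl⟩ := hM.exists_frameElt Z
  -- the discriminant of `Z + C t • E` is a monic quadratic polynomial in `t`
  have hp := quadratic_ne_zero (one_ne_zero (α := F)) (b := 2 * (z 0).eval 0)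
    (c := (z 0).eval 0 ^ 2 + 4 * (0 ^ e * (z 1).eval 0 * (z 2).eval 0))
  refine hM.mem_closure_of_line (finite_setOfPred_isRoot hp) (x' := (X ^ k : F[X]) • E)
    (y' := s • (X ^ k : F[X]) • E) fun t ht => ?_
  have hZ : frameElt E G H z0 z + C t • E = frameElt E G H z0 (z + ![C t, 0, 0]) := by
    simp only [frameElt, Pi.add_apply, Matrix.cons_val]
    module
  have hx : a • 1 + (X ^ k : F[X]) • frameElt E G H z0 z + C t • (X ^ k : F[X]) • E =
      a • 1 + (X ^ k : F[X]) • frameElt E G H z0 (z + ![C t, 0, 0]) := by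
    rw [← hZ]
    module
  have hy : r • 1 + s • (a • 1 + (X ^ k : F[X]) • frameElt E G H z0 z) +
      (X ^ (q - k) : F[X]) • W + C t • s • (X ^ k : F[X]) • E =
      r • 1 + s • (a • 1 + (X ^ k : F[X]) • frameElt E G H z0 (z + ![C t, 0, 0])) +
        (X ^ (q - k) : F[X]) • W := by
    rw [← hZ]
    module
  rw [hx, hy]
  refine hM.mem_closure_of_discrim_ne_zero hk hkq ha hr fun h => ht ?_
  simp only [Pi.add_apply, Matrix.cons_val, add_zero, eval_add, eval_mul, eval_pow, eval_X, eval_C,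
    eval_ofNat] at h
  simp only [Set.mem_ofPred_eq, IsRoot.def, eval_add, eval_mul, eval_pow, eval_X, eval_C]
  linear_combination h

/-- A commuting pair whose coordinates are divisible exactly by `X ^ k`: the vanishing of the
minors expresses the second element through the first one up to a multiple of `X ^ (q - k)`. -/
theorem mem_closure_of_exact_order [IsAlgClosed F] {k : ℕ} (hk : 0 < k) (hkq : 2 * k ≤ q)
    {a a' : F[X]} {z z' : Fin 3 → F[X]} {i : Fin 3} (hz : (z i).eval 0 ≠ 0)
    (ha : a.eval 0 = 0) (ha' : a'.eval 0 = 0)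
    (hc : Commute (frameElt E G H a ((X ^ k : F[X]) • z))
      (frameElt E G H a' ((X ^ k : F[X]) • z'))) :
    (ρ (frameElt E G H a ((X ^ k : F[X]) • z)), ρ (frameElt E G H a' ((X ^ k : F[X]) • z'))) ∈
      @closure _ (pairZariski F n) (unimodularPairs A q E G H ρ) := by
  rw [hM.commute_iff] at hc
  have hminor : ∀ j, X ^ (q - 2 * k) ∣ z i * z' j - z j * z' i := by
    intro j
    have h1 := hc i j
    have h2 : ((X ^ k : F[X]) • z) i * ((X ^ k : F[X]) • z') j -
        ((X ^ k : F[X]) • z) j * ((X ^ k : F[X]) • z') i =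
        X ^ (2 * k) * (z i * z' j - z j * z' i) := by
      simp only [Pi.smul_apply, smul_eq_mul]
      ring
    have h3 : (X ^ q : F[X]) = X ^ (2 * k) * X ^ (q - 2 * k) := by
      rw [← pow_add, Nat.add_sub_cancel' hkq]
    rwa [h2, h3, mul_dvd_mul_iff_left (pow_ne_zero _ X_ne_zero)] at h1
  obtain ⟨s, hs⟩ := exists_multiplier hz hminor
  choose w hw using hs
  have h1 := hM.mem_closure_of_two_mul_le hk hkq (a := a) (r := a' - s * a) (s := s)
    (Z := frameElt E G H 0 z) (W := frameElt E G H 0 w) ha (by simp [ha, ha'])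
  have hpow : (X ^ (q - k) : F[X]) = X ^ k * X ^ (q - 2 * k) := by
    rw [← pow_add]
    congr 1
    omega
  convert h1 using 3
  · rw [← frameElt_zero E G H, smul_frameElt, frameElt_add, mul_zero, add_zero, zero_add]
  · rw [← frameElt_zero E G H, ← frameElt_zero E G H]
    simp only [smul_frameElt, frameElt_add]
    congr 1
    · ring
    · ext1 j
      simp only [Pi.add_apply, Pi.smul_apply, Pi.zero_apply, smul_eq_mul, hpow]
      linear_combination X ^ k * hw j

/-- Every commuting nilpotent pair is a limit of unimodular ones. -/
theorem nilpotentPairs_subset_closure [IsAlgClosed F] :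
    nilpotentPairs A ⊆ @closure _ (pairZariski F n) (unimodularPairs A q E G H ρ) := by
  have : Infinite F := IsAlgClosed.instInfinite
  rintro ⟨B, D⟩ hP
  obtain ⟨x, rfl⟩ := hM.exists_eq_of_commute B hP.1.1
  obtain ⟨y, rfl⟩ := hM.exists_eq_of_commute D hP.1.2.1
  obtain ⟨a, u, rfl⟩ := hM.exists_frameElt x
  obtain ⟨a', u', rfl⟩ := hM.exists_frameElt y
  have hP' := hM.map_mem_nilpotentPairs_iff.1 hP
  obtain ⟨hc, hx, hy⟩ := hP'
  by_cases hu : IsUnimodularTriple q u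
  · exact @subset_closure _ (pairZariski F n) _ _ ⟨hP, a, u, hu, rfl⟩
  have hq : 0 < q := by
    by_contra h
    obtain rfl : q = 0 := by omega
    exact hu fun g _ => by simp
  have hu0 : ∀ i, (u i).eval 0 = 0 := by
    by_contra! h
    obtain ⟨i, hi⟩ := h
    exact hu (isUnimodularTriple_of_eval_ne_zero hi q)
  -- pairs on the line through `(x, y)` in the direction `(y, 0)`
  have hline : ∀ t : F, frameElt E G H a u + C t • frameElt E G H a' u' =
      frameElt E G H (a + C t * a') (u + C t • u') := fun t => by
    rw [smul_frameElt, frameElt_add]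
  have hcomm : ∀ t : F, Commute (frameElt E G H a u + C t • frameElt E G H a' u')
      (frameElt E G H a' u') := fun t => hc.add_left ((Commute.refl _).smul_left _)
  have hnil : ∀ t : F, IsNilpotent (frameElt E G H a u + C t • frameElt E G H a' u') :=
    fun t => Commute.isNilpotent_add (hc.smul_right _) hx (hy.smul _)
  by_cases hu'0 : ∃ i, (u' i).eval 0 ≠ 0
  · obtain ⟨i, hi⟩ := hu'0
    refine hM.mem_closure_of_line (Set.finite_singleton (0 : F)) (x' := frameElt E G H a' u')
      (y' := 0) fun t ht => ?_
    rw [Set.mem_singleton_iff] at ht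
    rw [smul_zero, add_zero]
    refine @subset_closure _ (pairZariski F n) _ _
      ⟨hM.map_mem_nilpotentPairs_iff.2 ⟨hcomm t, hnil t, hy⟩, _, _, ?_, congrArg ρ (hline t)⟩
    refine isUnimodularTriple_of_eval_ne_zero (i := i) ?_ q
    simp [hu0, ht, hi]
  push Not at hu'0
  have hscalar : ∀ {b : F[X]} {v : Fin 3 → F[X]}, (∀ i, (v i).eval 0 = 0) →
      IsNilpotent (frameElt E G H b v) → b.eval 0 = 0 := by
    intro b v hv h
    have h1 := (hM.eval_eq_zero_of_isNilpotent hq h).2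
    simpa [hv] using h1
  have ha := hscalar hu0 hx
  have ha' := hscalar hu'0 hy
  -- the largest power of `X`, at most `X ^ q`, dividing all coordinates
  classical
  let P : ℕ → Prop := fun k => ∀ i, X ^ k ∣ u i ∧ X ^ k ∣ u' i
  obtain ⟨k, hkdef⟩ : ∃ k, k = Nat.findGreatest P q := ⟨_, rfl⟩
  have hP1 : P 1 := fun i => by
    rw [pow_one]
    exact ⟨X_dvd_iff_eval_zero.2 (hu0 i), X_dvd_iff_eval_zero.2 (hu'0 i)⟩
  have hk : 0 < k := hkdef ▸ Nat.le_findGreatest hq hP1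
  have hkP : P k := hkdef ▸ Nat.findGreatest_spec hq hP1
  have hkq : k ≤ q := hkdef ▸ Nat.findGreatest_le q
  choose z hz using fun i => (hkP i).1
  choose z' hz' using fun i => (hkP i).2
  obtain rfl : u = (X ^ k : F[X]) • z := funext hz
  obtain rfl : u' = (X ^ k : F[X]) • z' := funext hz'
  rcases Nat.lt_or_ge q (2 * k) with h2k | h2k
  · -- here `X ^ k` is a multiple of `X ^ (q - k)`, and the cofactor makes `W` nilpotent
    have hne : 2 * k - q ≠ 0 := by omega
    have h1 := hM.mem_closure_of_isNilpotent hk hkq (a := a) (r := a') (s := 0)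
      (Z := frameElt E G H 0 z) (W := (X ^ (2 * k - q) : F[X]) • frameElt E G H 0 z') ha ha'
      (hM.isNilpotent_smul_of_eval_eq_zero (by simp [zero_pow hne]) _)
    have hpow : (X ^ (q - k) : F[X]) * X ^ (2 * k - q) = X ^ k := by
      rw [← pow_add]
      congr 1
      omega
    have hform : ∀ (b : F[X]) (v : Fin 3 → F[X]), frameElt E G H b ((X ^ k : F[X]) • v) =
        b • 1 + (X ^ k : F[X]) • frameElt E G H 0 v := fun b v => by
      rw [← frameElt_zero E G H, smul_frameElt, frameElt_add, mul_zero, add_zero, zero_add]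
    rw [smul_smul, hpow, zero_smul, add_zero] at h1
    rwa [hform, hform]
  · by_cases hzi : ∃ i, (z i).eval 0 ≠ 0
    · obtain ⟨i, hi⟩ := hzi
      exact hM.mem_closure_of_exact_order hk h2k hi ha ha' hc
    · push Not at hzi
      obtain ⟨i, hi⟩ : ∃ i, (z' i).eval 0 ≠ 0 := by
        by_contra! hcon
        refine Nat.findGreatest_is_greatest (P := P) (n := q) (k := k + 1) (by omega) (by omega)
          fun i => ?_
        rw [pow_succ]
        exact ⟨mul_dvd_mul_left _ (X_dvd_iff_eval_zero.2 (hzi i)),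
          mul_dvd_mul_left _ (X_dvd_iff_eval_zero.2 (hcon i))⟩
      -- adding a multiple of the second element to the first one reduces to the previous case
      refine hM.mem_closure_of_line (Set.finite_singleton (0 : F))
        (x' := frameElt E G H a' ((X ^ k : F[X]) • z')) (y' := 0) fun t ht => ?_
      rw [Set.mem_singleton_iff] at ht
      have hsum : (X ^ k : F[X]) • z + C t • (X ^ k : F[X]) • z' =
          (X ^ k : F[X]) • (z + C t • z') := by module
      have hct := hcomm t
      rw [hline, hsum] at hct
      rw [smul_zero, add_zero, hline, hsum]
      refine hM.mem_closure_of_exact_order (i := i) hk h2k ?_ ?_ ha' hct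
      · simp [hzi, ht, hi]
      · simp [ha, ha']

end IsTwoBlockModel

end Model

/-! ### The dimension of the algebra generated by a unimodular pair -/

section Dimension

variable {F K : Type*} [Field F] [Ring K] [Algebra F[X] K] {n : ℕ}

namespace IsTwoBlockModel

variable {A : Matrix (Fin n) (Fin n) F} {q e : ℕ} {E G H : K}
  {ρ : K →+* Matrix (Fin n) (Fin n) F} (hM : IsTwoBlockModel A q e E G H ρ)
include hM

theorem map_smul_one (p : F[X]) : ρ (p • 1) = aeval A p := by
  rw [hM.map_smul, map_one, mul_one]

/-- By the Cayley–Hamilton relation, the algebra generated by `A` and a matrix `B` in the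
centralizer of `A` consists of the elements `f(A) + g(A) B`. -/
theorem mem_adjoin_iff (x : K) (M : Matrix (Fin n) (Fin n) F) :
    M ∈ Algebra.adjoin F ({A, ρ x} : Set (Matrix (Fin n) (Fin n) F)) ↔
      ∃ f g : F[X], M = ρ (f • 1 + g • x) := by
  constructor
  · intro h
    induction h using Algebra.adjoin_induction with
    | mem M h =>
      rcases h with rfl | rfl
      · exact ⟨X, 0, by rw [zero_smul, add_zero, hM.map_smul_one, aeval_X]⟩
      · exact ⟨0, 1, by simp⟩
    | algebraMap c => exact ⟨C c, 0, by rw [zero_smul, add_zero, hM.map_smul_one, aeval_C]⟩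
    | add M N _ _ h h' =>
      obtain ⟨f, g, rfl⟩ := h
      obtain ⟨f', g', rfl⟩ := h'
      exact ⟨f + f', g + g', by rw [← map_add]; congr 1; module⟩
    | mul M N _ _ h h' =>
      obtain ⟨f, g, rfl⟩ := h
      obtain ⟨f', g', rfl⟩ := h'
      obtain ⟨a, u, hx⟩ := hM.exists_frameElt x
      have hCH := hM.frameElt_mul_self a u
      rw [← hx] at hCH
      refine ⟨f * f' - g * g' * (a * (a + u 0) - X ^ e * u 1 * u 2),
        f * g' + g * f' + g * g' * (2 * a + u 0), ?_⟩
      rw [← map_mul]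
      congr 1
      simp only [add_mul, mul_add, smul_mul_assoc, mul_smul_comm, one_mul, mul_one, hCH]
      module
  · rintro ⟨f, g, rfl⟩
    have hA : A ∈ Algebra.adjoin F ({A, ρ x} : Set (Matrix (Fin n) (Fin n) F)) :=
      Algebra.subset_adjoin (Set.mem_insert _ _)
    have hp : ∀ p : F[X], aeval A p ∈ Algebra.adjoin F ({A, ρ x} : Set (Matrix _ _ F)) := by
      intro p
      have h1 := (aeval (⟨A, hA⟩ : Algebra.adjoin F ({A, ρ x} : Set (Matrix _ _ F))) p).2
      rwa [← Subalgebra.coe_val, ← aeval_algHom_apply] at h1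
    rw [map_add, hM.map_smul_one, hM.map_smul]
    exact add_mem (hp f) (mul_mem (hp g)
      (Algebra.subset_adjoin (Set.mem_insert_of_mem _ (Set.mem_singleton _))))

theorem finrank_adjoin {a : F[X]} {u : Fin 3 → F[X]} (hu : IsUnimodularTriple q u) :
    Module.finrank F (Algebra.adjoin F
      ({A, ρ (frameElt E G H a u)} : Set (Matrix (Fin n) (Fin n) F))) = n := by
  set x := frameElt E G H a u with hx
  -- representatives `f • 1 + g • x` with `f` and `g` of degree less than `q + e` and `q`
  let φ : (degreeLT F (q + e) × degreeLT F q) →ₗ[F] Matrix (Fin n) (Fin n) F :=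
    { toFun := fun p => ρ ((p.1 : F[X]) • 1 + (p.2 : F[X]) • x)
      map_add' := fun p p' => by
        rw [← map_add]
        congr 1
        simp only [Prod.fst_add, Prod.snd_add, Submodule.coe_add]
        module
      map_smul' := fun c p => by
        simp only [Prod.smul_fst, Prod.smul_snd, SetLike.val_smul, smul_eq_C_mul, RingHom.id_apply]
        rw [← hM.map_C_smul]
        congr 1
        module }
  have hzero : ∀ f g : F[X], f • 1 + g • x = frameElt E G H (f + g * a) (g • u) := fun f g => by
    rw [← frameElt_zero E G H, hx, smul_frameElt, frameElt_add, zero_add]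
  have hinj : Function.Injective φ := by
    rw [← LinearMap.ker_eq_bot, LinearMap.ker_eq_bot']
    rintro ⟨⟨f, hf⟩, ⟨g, hg⟩⟩ h
    change ρ (f • 1 + g • x) = 0 at h
    rw [map_eq_zero_iff ρ hM.injective, hzero, hM.frameElt_eq_zero_iff] at h
    have hg0 : g = 0 := by
      refine eq_zero_of_dvd_of_degree_lt (hu g h.2) ?_
      rw [degree_X_pow]
      exact mem_degreeLT.1 hg
    subst hg0
    rw [zero_mul, add_zero] at h
    have hf0 : f = 0 := by
      refine eq_zero_of_dvd_of_degree_lt h.1 ?_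
      rw [degree_X_pow]
      exact mem_degreeLT.1 hf
    subst hf0
    rfl
  have hrange : LinearMap.range φ =
      Subalgebra.toSubmodule (Algebra.adjoin F ({A, ρ x} : Set _)) := by
    ext M
    rw [Subalgebra.mem_toSubmodule, hM.mem_adjoin_iff]
    constructor
    · rintro ⟨p, rfl⟩
      exact ⟨p.1, p.2, rfl⟩
    · rintro ⟨f, g, rfl⟩
      have hmod : ∀ (p : F[X]) (m : ℕ), p %ₘ X ^ m ∈ degreeLT F m := fun p m => by
        rw [mem_degreeLT]
        exact (degree_modByMonic_lt p (monic_X_pow m)).trans_eq (degree_X_pow m)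
      refine ⟨(⟨(f + X ^ q * (g /ₘ X ^ q) * a) %ₘ X ^ (q + e), hmod _ _⟩,
        ⟨g %ₘ X ^ q, hmod _ _⟩), ?_⟩
      change ρ (((f + X ^ q * (g /ₘ X ^ q) * a) %ₘ X ^ (q + e)) • 1 + (g %ₘ X ^ q) • x) = _
      congr 1
      rw [hzero, hzero, ← sub_eq_zero, frameElt_sub, hM.frameElt_eq_zero_iff]
      have h1 := modByMonic_add_div g (X ^ q : F[X])
      have h2 := modByMonic_add_div (f + X ^ q * (g /ₘ X ^ q) * a) (X ^ (q + e) : F[X])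
      constructor
      · refine ⟨-((f + X ^ q * (g /ₘ X ^ q) * a) /ₘ X ^ (q + e)), ?_⟩
        linear_combination h2 + a * h1
      · intro i
        refine ⟨-(g /ₘ X ^ q) * u i, ?_⟩
        simp only [Pi.sub_apply, Pi.smul_apply, smul_eq_mul]
        linear_combination u i * h1
  have h1 := LinearMap.finrank_range_of_inj hinj
  rw [hrange, Module.finrank_prod, (degreeLTEquiv F _).finrank_eq, (degreeLTEquiv F _).finrank_eq,
    Module.finrank_fin_fun, Module.finrank_fin_fun, hM.size_eq] at h1
  exact h1

theorem unimodularPairs_subset_fullPairs : unimodularPairs A q E G H ρ ⊆ fullPairs A := by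
  rintro ⟨B, D⟩ ⟨hP, a, u, hu, hB⟩
  refine ⟨hP, ?_⟩
  rw [hB]
  exact hM.finrank_adjoin hu

end IsTwoBlockModel

end Dimension

/-! ### Curves in the variety of commuting nilpotent pairs -/

section Irreducible

variable {F K : Type*} [Field F] [Ring K] [Algebra F[X] K] {n : ℕ}

/-- Every solution of `a ^ 2 + b * c = 0` is in the image of the parametrization of the cone of
nilpotent `2 × 2` matrices. -/
theorem exists_nilpotent_cone_param {a b c : F} (h : a ^ 2 + b * c = 0) :
    ∃ k x y : F, a = k * x * y ∧ b = k * x ^ 2 ∧ c = -(k * y ^ 2) := by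
  by_cases hb : b = 0
  · have ha : a = 0 := eq_zero_of_pow_eq_zero (n := 2) (by simpa [hb] using h)
    exact ⟨-c, 0, 1, by simp [ha], by simp [hb], by simp⟩
  · refine ⟨b, 1, a / b, by field_simp, by simp, ?_⟩
    field_simp
    linear_combination h

namespace IsTwoBlockModel

variable {A : Matrix (Fin n) (Fin n) F} {q e : ℕ} {E G H : K}
  {ρ : K →+* Matrix (Fin n) (Fin n) F} (hM : IsTwoBlockModel A q e E G H ρ)
include hM

theorem isPolynomialCurve_smul (p : F[X]) {f : F → K} (hf : IsPolynomialCurve fun t => ρ (f t)) :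
    IsPolynomialCurve fun t => ρ (C (p.eval t) • f t) := by
  simpa only [hM.map_C_smul] using hf.smul p

/-- On the segment between `frameElt E G H a u` and `frameElt E G H a' u'` the constant terms of
the coordinates are replaced by arbitrary polynomial functions with the same end points. -/
theorem exists_curve (a a' : F[X]) (u u' : Fin 3 → F[X]) (r : F[X]) (v : Fin 3 → F[X])
    (hr0 : r.eval 0 = a.eval 0) (hr1 : r.eval 1 = a'.eval 0)
    (hv0 : ∀ i, (v i).eval 0 = (u i).eval 0) (hv1 : ∀ i, (v i).eval 1 = (u' i).eval 0) :
    ∃ (b : F → F[X]) (w : F → Fin 3 → F[X]),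
      IsPolynomialCurve (fun t => ρ (frameElt E G H (b t) (w t))) ∧
      frameElt E G H (b 0) (w 0) = frameElt E G H a u ∧
      frameElt E G H (b 1) (w 1) = frameElt E G H a' u' ∧
      ∀ t, (b t).eval 0 = r.eval t ∧ ∀ i, (w t i).eval 0 = (v i).eval t := by
  -- interpolation of one coordinate
  let c : F[X] → F[X] → F[X] → F → F[X] := fun p p' s t =>
    C ((1 - X : F[X]).eval t) * (p - C (p.eval 0)) + C ((X : F[X]).eval t) * (p' - C (p'.eval 0)) +
      C (s.eval t) * 1
  have hc : ∀ (p p' s : F[X]) (x : K), IsPolynomialCurve fun t => ρ (c p p' s t • x) := by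
    intro p p' s x
    have h1 := (hM.isPolynomialCurve_smul (1 - X)
      (IsPolynomialCurve.const (ρ ((p - C (p.eval 0)) • x)))).add
      ((hM.isPolynomialCurve_smul X
        (IsPolynomialCurve.const (ρ ((p' - C (p'.eval 0)) • x)))).add
        (hM.isPolynomialCurve_smul s (IsPolynomialCurve.const (ρ x))))
    convert h1 using 2 with t
    rw [← map_add, ← map_add]
    congr 1
    simp only [c]
    module
  have hc0 : ∀ p p' s : F[X], s.eval 0 = p.eval 0 → c p p' s 0 = p := by
    intro p p' s h
    simp [c, h]
  have hc1 : ∀ p p' s : F[X], s.eval 1 = p'.eval 0 → c p p' s 1 = p' := by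
    intro p p' s h
    simp [c, h]
  have hct : ∀ (p p' s : F[X]) (t : F), (c p p' s t).eval 0 = s.eval t := by
    intro p p' s t
    simp [c]
  refine ⟨c a a' r, fun t i => c (u i) (u' i) (v i) t, ?_, ?_, ?_, fun t => ⟨hct _ _ _ _,
    fun i => hct _ _ _ _⟩⟩
  · simp only [frameElt, map_add]
    exact (((hc _ _ _ _).add (hc _ _ _ _)).add (hc _ _ _ _)).add (hc _ _ _ _)
  · congr 1
    · exact hc0 _ _ _ hr0
    · exact funext fun i => hc0 _ _ _ (hv0 i)
  · congr 1
    · exact hc1 _ _ _ hr1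
    · exact funext fun i => hc1 _ _ _ (hv1 i)

/-- Any two nilpotent elements lie on a polynomial curve of nilpotent elements. -/
theorem exists_nilpotent_curve {x y : K} (hx : IsNilpotent x) (hy : IsNilpotent y) :
    ∃ f : F → K, IsPolynomialCurve (fun t => ρ (f t)) ∧ f 0 = x ∧ f 1 = y ∧
      ∀ t, IsNilpotent (f t) := by
  rcases Nat.eq_zero_or_pos q with rfl | hq
  · -- `K` is commutative in this case
    have hxy : Commute x y := by
      have h1 := hM.X_pow_smul_commute x y
      rwa [pow_zero, one_smul] at h1
    refine ⟨fun t => x + C t • (y - x), hM.isPolynomialCurve_line _ _, by simp, by simp,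
      fun t => ?_⟩
    have hc : Commute x (y - x) := hxy.sub_right (Commute.refl x)
    refine Commute.isNilpotent_add (hc.smul_right _) hx (IsNilpotent.smul ?_ _)
    exact hxy.symm.isNilpotent_sub hy hx
  obtain ⟨a, u, rfl⟩ := hM.exists_frameElt x
  obtain ⟨a', u', rfl⟩ := hM.exists_frameElt y
  rw [hM.isNilpotent_frameElt_iff hq] at hx hy
  simp only [eval_add, eval_mul, eval_sub, eval_pow, eval_X, eval_ofNat] at hx hy
  -- polynomial functions satisfying the equations of nilpotency, for the constant terms
  obtain ⟨r, v, hr0, hr1, hv0, hv1, htr, hdet⟩ : ∃ (r : F[X]) (v : Fin 3 → F[X]),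
      r.eval 0 = a.eval 0 ∧ r.eval 1 = a'.eval 0 ∧ (∀ i, (v i).eval 0 = (u i).eval 0) ∧
      (∀ i, (v i).eval 1 = (u' i).eval 0) ∧ 2 * r + v 0 = 0 ∧
      r * (r + v 0) - C (0 ^ e) * v 1 * v 2 = 0 := by
    have htx : (u 0).eval 0 = -2 * a.eval 0 := by linear_combination hx.1
    have hty : (u' 0).eval 0 = -2 * a'.eval 0 := by linear_combination hy.1
    rcases Nat.eq_zero_or_pos e with rfl | he
    · simp only [pow_zero, one_mul] at hx hy
      obtain ⟨k, l, m, h1, h2, h3⟩ := exists_nilpotent_cone_param (a := a.eval 0)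
        (b := (u 1).eval 0) (c := (u 2).eval 0) (by linear_combination a.eval 0 * hx.1 - hx.2)
      obtain ⟨k', l', m', h1', h2', h3'⟩ := exists_nilpotent_cone_param (a := a'.eval 0)
        (b := (u' 1).eval 0) (c := (u' 2).eval 0) (by linear_combination a'.eval 0 * hy.1 - hy.2)
      let s : F → F → F[X] := fun c c' => C c + X * C (c' - c)
      have hs0 : ∀ c c', (s c c').eval 0 = c := fun c c' => by simp [s]
      have hs1 : ∀ c c', (s c c').eval 1 = c' := fun c c' => by simp [s]
      refine ⟨s k k' * s l l' * s m m', ![-2 * (s k k' * s l l' * s m m'),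
        s k k' * s l l' ^ 2, -(s k k' * s m m' ^ 2)], ?_, ?_, ?_, ?_, ?_, ?_⟩
      · simp only [eval_mul, hs0, h1]
      · simp only [eval_mul, hs1, h1']
      · intro i
        fin_cases i <;> simp [hs0, h1, h2, h3, htx]
      · intro i
        fin_cases i <;> simp [hs1, h1', h2', h3', hty]
      · simp only [Matrix.cons_val]
        ring
      · simp only [Matrix.cons_val, pow_zero, C_1]
        ring
    · rw [zero_pow he.ne'] at hx hy
      have ha : a.eval 0 = 0 :=
        eq_zero_of_pow_eq_zero (n := 2) (by linear_combination a.eval 0 * hx.1 - hx.2)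
      have ha' : a'.eval 0 = 0 :=
        eq_zero_of_pow_eq_zero (n := 2) (by linear_combination a'.eval 0 * hy.1 - hy.2)
      refine ⟨0, ![0, C ((u 1).eval 0) + X * C ((u' 1).eval 0 - (u 1).eval 0),
        C ((u 2).eval 0) + X * C ((u' 2).eval 0 - (u 2).eval 0)], ?_, ?_, ?_, ?_, ?_, ?_⟩
      · simp [ha]
      · simp [ha']
      · intro i
        fin_cases i <;> simp [htx, ha]
      · intro i
        fin_cases i <;> simp [hty, ha']
      · simp
      · simp [zero_pow he.ne']
  obtain ⟨b, w, hcurve, h0, h1, ht⟩ := hM.exists_curve a a' u u' r v hr0 hr1 hv0 hv1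
  refine ⟨_, hcurve, h0, h1, fun t => ?_⟩
  rw [hM.isNilpotent_frameElt_iff hq]
  obtain ⟨hb, hw⟩ := ht t
  have h2 := congrArg (eval t) htr
  have h3 := congrArg (eval t) hdet
  simp only [eval_add, eval_mul, eval_sub, eval_pow, eval_X, eval_ofNat, eval_C, eval_zero, hb,
    hw] at h2 h3 ⊢
  exact ⟨h2, h3⟩

/-- The second component of a unimodular pair is a polynomial in `A` and the first one. -/
theorem exists_eq_of_mem_unimodularPairs
    {P : Matrix (Fin n) (Fin n) F × Matrix (Fin n) (Fin n) F}
    (hP : P ∈ unimodularPairs A q E G H ρ) :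
    ∃ (x : K) (r s : F[X]), IsNilpotent x ∧ IsNilpotent (r • (1 : K)) ∧
      P = (ρ x, ρ (r • 1 + s • x)) := by
  obtain ⟨B, D⟩ := P
  obtain ⟨hP, a, u, hu, hB⟩ := hP
  obtain ⟨y, rfl⟩ := hM.exists_eq_of_commute D hP.1.2.1
  obtain rfl : B = ρ (frameElt E G H a u) := hB
  obtain ⟨a', u', rfl⟩ := hM.exists_frameElt y
  obtain ⟨hc, hx, hy⟩ := hM.map_mem_nilpotentPairs_iff.1 hP
  obtain ⟨s, hs⟩ : ∃ s : F[X], ∀ j, X ^ q ∣ u' j - s * u j := by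
    rcases Nat.eq_zero_or_pos q with rfl | hq
    · exact ⟨0, fun j => by simp⟩
    · obtain ⟨i, hi⟩ := hu.exists_eval_ne_zero hq
      exact exists_multiplier hi fun j => hM.commute_iff.1 hc i j
  have h1 : frameElt E G H a' u' = (a' - s * a) • 1 + s • frameElt E G H a u := by
    rw [← frameElt_zero E G H, smul_frameElt, frameElt_add, sub_add_cancel, zero_add]
    exact hM.frameElt_congr hs
  refine ⟨_, a' - s * a, s, hx, ?_, by rw [h1]⟩
  rw [← sub_eq_iff_eq_add] at h1
  rw [← h1]
  exact Commute.isNilpotent_sub (hc.symm.smul_right _) hy (hx.smul _)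

theorem isPreirreducible_nilpotentPairs [IsAlgClosed F] :
    @IsPreirreducible _ (pairZariski F n) (nilpotentPairs A) := by
  have : Infinite F := IsAlgClosed.instInfinite
  refine isPreirreducible_pairZariski_of_curves hM.nilpotentPairs_subset_closure
    fun P hP Q hQ => ?_
  obtain ⟨x, r, s, hx, hr, rfl⟩ := hM.exists_eq_of_mem_unimodularPairs hP
  obtain ⟨x', r', s', hx', hr', rfl⟩ := hM.exists_eq_of_mem_unimodularPairs hQ
  obtain ⟨f, hf, hf0, hf1, hfn⟩ := hM.exists_nilpotent_curve hx hx'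
  let c : F[X] → F[X] → F → F[X] := fun p p' t => p + C t * (p' - p)
  have hcurve : ∀ p p' : F[X], IsPolynomialCurve fun t => ρ (c p p' t • 1) := fun p p' => by
    convert hM.isPolynomialCurve_line (p • 1) ((p' - p) • 1) using 3 with t
    simp only [c]
    module
  refine ⟨fun t => ρ (f t), fun t => ρ (c r r' t • 1 + c s s' t • f t), hf, ?_, fun t => ?_, ?_, ?_⟩
  · convert (hcurve r r').add ((hcurve s s').mul hf) using 2 with t
    rw [← map_mul, ← map_add, smul_mul_assoc, one_mul]
  · have hcomm : ∀ (p : F[X]) (y : K), Commute y (p • 1) := fun p y =>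
      (Commute.one_right y).smul_right p
    rw [hM.map_mem_nilpotentPairs_iff]
    refine ⟨(hcomm _ _).add_right ((Commute.refl _).smul_right _), hfn t, ?_⟩
    refine Commute.isNilpotent_add (hcomm _ _).symm ?_ ((hfn t).smul _)
    have h1 : c r r' t • (1 : K) = r • 1 + C t • (r' • 1 - r • 1) := by
      simp only [c]
      module
    rw [h1]
    refine Commute.isNilpotent_add ?_ hr (IsNilpotent.smul ?_ _)
    · exact (hcomm r _).symm
    · exact (hcomm _ _).isNilpotent_sub hr' hr
  · simp [c, hf0]
  · simp [c, hf1]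

end IsTwoBlockModel

end Irreducible

/-! ### Nilpotent matrices with at most two Jordan blocks -/

section Structure

variable {F : Type*} [Field F]

/-- The cyclic `F[X]`-module `F[X] / X ^ p`. -/
abbrev JordanBlock (F : Type*) [Field F] (p : ℕ) : Type _ := F[X] ⧸ F[X] ∙ (X ^ p : F[X])

/-- The canonical generator of `F[X] / X ^ p`. -/
noncomputable def JordanBlock.gen (F : Type*) [Field F] (p : ℕ) : JordanBlock F p :=
  (F[X] ∙ (X ^ p : F[X])).mkQ 1

namespace JordanBlock

theorem mkQ_eq_smul_gen {p : ℕ} (a : F[X]) : (F[X] ∙ (X ^ p : F[X])).mkQ a = a • gen F p := by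
  rw [gen, ← map_smul, smul_eq_mul, mul_one]

theorem exists_eq_smul_gen {p : ℕ} (x : JordanBlock F p) : ∃ a : F[X], x = a • gen F p := by
  obtain ⟨a, rfl⟩ := Submodule.mkQ_surjective _ x
  exact ⟨a, mkQ_eq_smul_gen a⟩

theorem smul_gen_eq_zero_iff {p : ℕ} {a : F[X]} : a • gen F p = 0 ↔ X ^ p ∣ a := by
  rw [← mkQ_eq_smul_gen, Submodule.mkQ_apply, Submodule.Quotient.mk_eq_zero,
    Submodule.mem_span_singleton]
  simp only [smul_eq_mul, mul_comm _ (X ^ p : F[X]), dvd_def, eq_comm]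

/-- The linear map out of `F[X] / X ^ p` that sends the generator to a given vector annihilated by
`X ^ p`. -/
noncomputable def lift {V : Type*} [AddCommGroup V] [Module F[X] V] {p : ℕ} (v : V)
    (hv : (X ^ p : F[X]) • v = 0) : JordanBlock F p →ₗ[F[X]] V :=
  Submodule.liftQ _ (LinearMap.toSpanSingleton F[X] V v) (by
    rw [Submodule.span_singleton_le_iff_mem, LinearMap.mem_ker, LinearMap.toSpanSingleton_apply,
      hv])

theorem lift_gen {V : Type*} [AddCommGroup V] [Module F[X] V] {p : ℕ} (v : V)
    (hv : (X ^ p : F[X]) • v = 0) : lift v hv (gen F p) = v := by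
  rw [lift, gen, Submodule.mkQ_apply, Submodule.liftQ_apply, LinearMap.toSpanSingleton_apply,
    one_smul]

theorem X_pow_smul_gen {m p : ℕ} (h : p ≤ m) : (X ^ m : F[X]) • gen F p = 0 :=
  smul_gen_eq_zero_iff.2 (pow_dvd_pow X h)

theorem subsingleton_zero : Subsingleton (JordanBlock F 0) := by
  refine subsingleton_of_forall_eq 0 fun x => ?_
  obtain ⟨a, rfl⟩ := exists_eq_smul_gen x
  rw [smul_gen_eq_zero_iff, pow_zero]
  exact one_dvd a

theorem finrank_eq (p : ℕ) : Module.finrank F (JordanBlock F p) = p := by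
  have h := finrank_quotient_span_eq_natDegree (K := F) (f := (X ^ p : F[X]))
  rwa [natDegree_X_pow] at h

instance (p : ℕ) : Module.Finite F (JordanBlock F p) :=
  (monic_X_pow p).finite_quotient

end JordanBlock

open JordanBlock

/-- The endomorphism ring of `F[X] / X ^ (q + e) × F[X] / X ^ q` has a frame. -/
theorem exists_isTwoBlockFrame (q e : ℕ) :
    ∃ E G H : Module.End F[X] (JordanBlock F (q + e) × JordanBlock F q),
      IsTwoBlockFrame F q e E G H := by
  have hext : ∀ f g : Module.End F[X] (JordanBlock F (q + e) × JordanBlock F q),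
      f (gen F (q + e), 0) = g (gen F (q + e), 0) → f (0, gen F q) = g (0, gen F q) → f = g := by
    intro f g h1 h2
    refine LinearMap.ext fun ⟨x, y⟩ => ?_
    obtain ⟨a, rfl⟩ := exists_eq_smul_gen x
    obtain ⟨b, rfl⟩ := exists_eq_smul_gen y
    have h3 : ((a • gen F (q + e), b • gen F q) : JordanBlock F (q + e) × JordanBlock F q) =
        a • (gen F (q + e), 0) + b • (0, gen F q) := by simp
    rw [h3, map_add, map_add, map_smul, map_smul, map_smul, map_smul, h1, h2]
  let E : Module.End F[X] (JordanBlock F (q + e) × JordanBlock F q) :=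
    LinearMap.inr _ _ _ ∘ₗ LinearMap.snd _ _ _
  let G : Module.End F[X] (JordanBlock F (q + e) × JordanBlock F q) :=
    LinearMap.inl _ _ _ ∘ₗ lift ((X ^ e : F[X]) • gen F (q + e)) (by
      rw [smul_smul, ← pow_add]
      exact X_pow_smul_gen le_rfl) ∘ₗ LinearMap.snd _ _ _
  let H : Module.End F[X] (JordanBlock F (q + e) × JordanBlock F q) :=
    LinearMap.inr _ _ _ ∘ₗ lift (gen F q) (X_pow_smul_gen (Nat.le_add_right q e)) ∘ₗ
      LinearMap.fst _ _ _
  have hE : ∀ x y, E (x, y) = (0, y) := fun x y => rfl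
  have hG : ∀ (x : JordanBlock F (q + e)) (b : F[X]),
      G (x, b • gen F q) = ((b * X ^ e) • gen F (q + e), 0) := fun x b => by
    simp [G, lift_gen, smul_smul]
  have hH : ∀ (a : F[X]) (y : JordanBlock F q),
      H (a • gen F (q + e), y) = (0, a • gen F q) := fun a y => by
    simp [H, lift_gen]
  have hG1 : ∀ x, G (x, gen F q) = ((X ^ e : F[X]) • gen F (q + e), 0) := fun x => by
    simpa using hG x 1
  have hG0 : ∀ x, G (x, 0) = 0 := fun x => by
    have h := hG x 0
    rwa [zero_smul, zero_mul, zero_smul] at h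
  have hH1 : ∀ y, H (gen F (q + e), y) = (0, gen F q) := fun y => by simpa using hH 1 y
  have hH0 : ∀ y, H (0, y) = 0 := fun y => by
    have h := hH 0 y
    rwa [zero_smul, zero_smul] at h
  refine ⟨E, G, H, ?_, ?_, ?_, ?_, ?_, ?_, ?_, ?_, ?_, fun x => ?_, fun a u => ?_⟩
  · refine hext _ _ ?_ ?_ <;> simp [hE]
  · refine hext _ _ ?_ ?_ <;> simp [hE, hG1, hG0]
  · refine hext _ _ ?_ ?_ <;> simp [hE, hH1, hH0]
  · refine hext _ _ ?_ ?_ <;> simp [hE, hG1, hG0]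
  · refine hext _ _ ?_ ?_ <;> simp [hG1, hG0]
  · refine hext _ _ ?_ ?_ <;> simp [hE, hH1, hH0, hG1]
  · refine hext _ _ ?_ ?_ <;> simp [hE, hH0]
  · refine hext _ _ ?_ ?_
    · simp only [Module.End.mul_apply, LinearMap.smul_apply, hG0, hE, map_zero]
      exact (smul_zero _).symm
    · simp [hE, hH, hG1]
  · refine hext _ _ ?_ ?_ <;> simp [hH1, hH0]
  · -- the images of the generators are the columns of the matrix of `x`
    obtain ⟨α, hα⟩ := exists_eq_smul_gen (x (gen F (q + e), 0)).1
    obtain ⟨γ, hγ⟩ := exists_eq_smul_gen (x (gen F (q + e), 0)).2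
    obtain ⟨β, hβ⟩ := exists_eq_smul_gen (x (0, gen F q)).1
    obtain ⟨δ, hδ⟩ := exists_eq_smul_gen (x (0, gen F q)).2
    have h1 : X ^ (q + e) ∣ X ^ q * β := by
      rw [← smul_gen_eq_zero_iff, mul_smul, ← hβ, ← Prod.smul_fst, ← map_smul, Prod.smul_mk,
        X_pow_smul_gen le_rfl, smul_zero]
      exact congrArg Prod.fst (map_zero x)
    rw [pow_add, mul_dvd_mul_iff_left (pow_ne_zero _ X_ne_zero)] at h1
    obtain ⟨b, rfl⟩ := h1
    refine ⟨α, ![δ - α, b, γ], hext _ _ ?_ ?_⟩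
    · refine Prod.ext ?_ ?_ <;> simp [hE, hG0, hH1, hα, hγ]
    · refine Prod.ext ?_ ?_ <;>
        simp [hE, hG1, hH0, hβ, hδ, smul_smul, mul_comm, ← add_smul]
  · have h1 : (a • 1 + u 0 • E + u 1 • G + u 2 • H :
        Module.End F[X] (JordanBlock F (q + e) × JordanBlock F q)) (gen F (q + e), 0) =
        (a • gen F (q + e), u 2 • gen F q) := by simp [hE, hG0, hH1]
    have h2 : (a • 1 + u 0 • E + u 1 • G + u 2 • H :
        Module.End F[X] (JordanBlock F (q + e) × JordanBlock F q)) (0, gen F q) =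
        ((u 1 * X ^ e) • gen F (q + e), (a + u 0) • gen F q) := by
      simp [hE, hG1, hH0, smul_smul, add_smul]
    have h3 : X ^ (q + e) ∣ u 1 * X ^ e ↔ X ^ q ∣ u 1 := by
      rw [pow_add, mul_dvd_mul_iff_right (pow_ne_zero _ X_ne_zero)]
    have h4 : (a • 1 + u 0 • E + u 1 • G + u 2 • H :
        Module.End F[X] (JordanBlock F (q + e) × JordanBlock F q)) = 0 ↔
        (X ^ (q + e) ∣ a ∧ X ^ q ∣ u 2) ∧ X ^ q ∣ u 1 ∧ X ^ q ∣ a + u 0 := by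
      rw [← h3, ← smul_gen_eq_zero_iff, ← smul_gen_eq_zero_iff, ← smul_gen_eq_zero_iff,
        ← smul_gen_eq_zero_iff, ← Prod.mk_eq_zero, ← Prod.mk_eq_zero, ← h1, ← h2]
      refine ⟨fun h => by simp [h], fun h => hext _ _ ?_ ?_⟩
      · rw [h.1, LinearMap.zero_apply]
      · rw [h.2, LinearMap.zero_apply]
    rw [h4]
    simp only [Fin.forall_fin_succ, Fin.isValue, Fin.succ_zero_eq_one, Fin.succ_one_eq_two,
      IsEmpty.forall_iff, and_true]
    constructor
    · rintro ⟨⟨ha, h2⟩, h1, h0⟩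
      exact ⟨ha, (dvd_add_right ((pow_dvd_pow X (Nat.le_add_right q e)).trans ha)).1 h0, h1, h2⟩
    · rintro ⟨ha, h0, h1, h2⟩
      exact ⟨⟨ha, h2⟩, h1, dvd_add ((pow_dvd_pow X (Nat.le_add_right q e)).trans ha) h0⟩

/-- A product of cyclic modules of which at most two are nonzero is a product of two of them. -/
theorem exists_linearEquiv_prod {d : ℕ} (k : Fin d → ℕ) (s : Finset (Fin d))
    (hs : ∀ i, i ∉ s → k i = 0) (hcard : s.card ≤ 2) :
    ∃ q e : ℕ, Nonempty ((∀ i, JordanBlock F (k i)) ≃ₗ[F[X]]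
      JordanBlock F (q + e) × JordanBlock F q) := by
  have hzero : ∀ i, i ∉ s → ∀ x y : JordanBlock F (k i), x = y := fun i hi => by
    rw [hs i hi]
    exact subsingleton_zero.elim
  have h0 : Subsingleton (JordanBlock F 0) := subsingleton_zero
  rcases Nat.lt_or_ge d 2 with hd | hd
  · interval_cases d
    · exact ⟨0, 0, ⟨LinearEquiv.ofBijective 0
        ⟨fun x y _ => Subsingleton.elim x y, fun y => ⟨0, Subsingleton.elim _ _⟩⟩⟩⟩
    · refine ⟨0, k 0, ?_⟩
      rw [zero_add]
      refine ⟨LinearEquiv.ofBijective (LinearMap.inl _ _ _ ∘ₗ LinearMap.proj 0) ⟨?_, ?_⟩⟩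
      · intro x y hxy
        funext i
        obtain rfl := Subsingleton.elim i 0
        exact congrArg Prod.fst hxy
      · rintro ⟨x, y⟩
        refine ⟨fun i => (Subsingleton.elim 0 i : (0 : Fin 1) = i) ▸ x, ?_⟩
        exact Prod.ext rfl (Subsingleton.elim _ _)
  · obtain ⟨t, hst, ht⟩ := Finset.exists_superset_card_eq hcard (by simpa using hd)
    obtain ⟨i, j, hij, rfl⟩ := Finset.card_eq_two.1 ht
    have hprod : ∀ i j, i ≠ j → (∀ l, l ∈ s → l = i ∨ l = j) →
        Nonempty ((∀ i, JordanBlock F (k i)) ≃ₗ[F[X]]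
          JordanBlock F (k i) × JordanBlock F (k j)) := by
      intro i j hij hs'
      refine ⟨LinearEquiv.ofBijective
        (LinearMap.prod (LinearMap.proj i) (LinearMap.proj j)) ⟨?_, ?_⟩⟩
      · intro x y hxy
        funext l
        by_cases hl : l ∈ s
        · rcases hs' l hl with rfl | rfl
          · exact congrArg Prod.fst hxy
          · exact congrArg Prod.snd hxy
        · exact hzero l hl _ _
      · rintro ⟨x, y⟩
        refine ⟨Pi.single i x + Pi.single j y, ?_⟩
        simp [hij, hij.symm]
    have hmem : ∀ l, l ∈ s → l = i ∨ l = j := fun l hl => by simpa using hst hl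
    rcases le_total (k j) (k i) with h | h
    · obtain ⟨e, he⟩ := Nat.exists_eq_add_of_le h
      have h1 := hprod i j hij hmem
      rw [he] at h1
      exact ⟨_, _, h1⟩
    · obtain ⟨e, he⟩ := Nat.exists_eq_add_of_le h
      have h1 := hprod j i hij.symm fun l hl => (hmem l hl).symm
      rw [he] at h1
      exact ⟨_, _, h1⟩

/-- Each nonzero cyclic summand contributes one dimension to the kernel of `X`. -/
theorem card_nonzero_blocks_le {V : Type*} [AddCommGroup V] [Module F V] [Module.Finite F V]
    (f : Module.End F V) {d : ℕ} (k : Fin d → ℕ)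
    (φ : Module.AEval' f ≃ₗ[F[X]] ∀ i, JordanBlock F (k i)) :
    (Finset.univ.filter fun i => k i ≠ 0).card ≤ Module.finrank F (f.eigenspace 0) := by
  classical
  set s := Finset.univ.filter fun i => k i ≠ 0
  -- the embedding of the socle of the nonzero blocks
  let χ : (s → F) →ₗ[F] ∀ i, JordanBlock F (k i) := LinearMap.pi fun i =>
    if h : i ∈ s then LinearMap.toSpanSingleton F (JordanBlock F (k i))
      ((X ^ (k i - 1) : F[X]) • gen F (k i)) ∘ₗ LinearMap.proj ⟨i, h⟩ else 0
  have hχ : ∀ c (i : s), χ c i = (C (c i) * X ^ (k i - 1) : F[X]) • gen F (k i) := by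
    intro c i
    simp only [χ, LinearMap.pi_apply, i.2, dite_true, LinearMap.comp_apply, LinearMap.proj_apply,
      LinearMap.toSpanSingleton_apply, mul_smul]
    exact (algebraMap_smul F[X] (c i) _).symm
  have hχ0 : ∀ c i, i ∉ s → χ c i = 0 := by
    intro c i hi
    simp [χ, hi]
  have hk : ∀ i : s, k i - 1 + 1 = k i := fun i => by
    have := (Finset.mem_filter.1 i.2).2
    omega
  have hX : ∀ c, (X : F[X]) • χ c = 0 := by
    intro c
    funext i
    rw [Pi.smul_apply, Pi.zero_apply]
    by_cases hi : i ∈ s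
    · rw [hχ c ⟨i, hi⟩, smul_smul, smul_gen_eq_zero_iff]
      refine ⟨C (c ⟨i, hi⟩), ?_⟩
      have := hk ⟨i, hi⟩
      simp only at this
      rw [← this, pow_succ, Nat.add_sub_cancel]
      ring
    · rw [hχ0 c i hi, smul_zero]
  let ψ : (s → F) →ₗ[F] V := (Module.AEval'.of f).symm.toLinearMap ∘ₗ
    (φ.symm.restrictScalars F).toLinearMap ∘ₗ χ
  have hψ : ∀ c, ψ c ∈ f.eigenspace 0 := by
    intro c
    rw [Module.End.mem_eigenspace_iff, zero_smul]
    change f ((Module.AEval'.of f).symm (φ.symm (χ c))) = 0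
    rw [← Module.AEval'.of_symm_X_smul, ← map_smul, hX, map_zero, map_zero]
  have hinj : Function.Injective ψ := by
    refine (Module.AEval'.of f).symm.injective.comp (φ.symm.injective.comp ?_)
    rw [← LinearMap.ker_eq_bot, LinearMap.ker_eq_bot']
    intro c hc
    funext i
    have h1 := congrFun hc i
    rw [hχ, Pi.zero_apply, smul_gen_eq_zero_iff] at h1
    nth_rewrite 1 [← hk i] at h1
    rw [pow_succ', mul_dvd_mul_iff_right (pow_ne_zero _ X_ne_zero), X_dvd_iff_eval_zero,
      eval_C] at h1
    exact h1
  have h1 := LinearMap.finrank_le_finrank_of_injective (f := ψ.codRestrict (f.eigenspace 0) hψ)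
    (fun x y h => hinj (congrArg Subtype.val h))
  rwa [Module.finrank_fintype_fun_eq_card, Fintype.card_coe] at h1

/-- The `F[X]`-module attached to a nilpotent `2`-regular matrix is a product of two Jordan blocks,
one of which may be zero. -/
theorem exists_aeval_linearEquiv {n : ℕ} {A : Matrix (Fin n) (Fin n) F} (hnil : IsNilpotent A)
    (hreg : IsRegularMatrix 2 A) :
    ∃ q e : ℕ, Nonempty (Module.AEval' (Matrix.toLin' A) ≃ₗ[F[X]]
      JordanBlock F (q + e) × JordanBlock F q) := by
  have htors : Module.IsTorsion' (Module.AEval' (Matrix.toLin' A))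
      (Submonoid.powers (X : F[X])) := by
    obtain ⟨m, hm⟩ := hnil
    intro v
    refine ⟨⟨X ^ m, m, rfl⟩, ?_⟩
    obtain ⟨v, rfl⟩ := (Module.AEval'.of (Matrix.toLin' A)).surjective v
    change (X ^ m : F[X]) • Module.AEval'.of (Matrix.toLin' A) v = 0
    rw [Module.AEval'.X_pow_smul_of, ← Matrix.toLin'_pow, hm]
    simp
  obtain ⟨d, k, ⟨φ⟩⟩ := Module.torsion_by_prime_power_decomposition irreducible_X htors
  let φ' : Module.AEval' (Matrix.toLin' A) ≃ₗ[F[X]] ∀ i, JordanBlock F (k i) :=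
    φ.trans (DirectSum.linearEquivFunOnFintype F[X] (Fin d) fun i => JordanBlock F (k i))
  obtain ⟨q, e, ⟨θ⟩⟩ := exists_linearEquiv_prod (F := F) k _ (fun i hi => by simpa using hi)
    ((card_nonzero_blocks_le _ k φ').trans (hreg 0))
  exact ⟨q, e, ⟨φ'.trans θ⟩⟩

/-- The embedding of the endomorphism ring of the `F[X]`-module attached to `A`, on which `X` acts
as `A`, into the ring of matrices. -/
noncomputable def endToMatrix {n : ℕ} (A : Matrix (Fin n) (Fin n) F) :
    Module.End F[X] (Module.AEval' (Matrix.toLin' A)) →+* Matrix (Fin n) (Fin n) F where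
  toFun f := LinearMap.toMatrix' ((Module.AEval'.of (Matrix.toLin' A)).symm.toLinearMap ∘ₗ
    f.restrictScalars F ∘ₗ (Module.AEval'.of (Matrix.toLin' A)).toLinearMap)
  map_one' := by
    rw [← LinearMap.toMatrix'_one]
    congr 1
  map_mul' f g := by
    rw [← LinearMap.toMatrix'_mul]
    congr 1
  map_zero' := by
    rw [LinearMap.restrictScalars_zero, LinearMap.zero_comp, LinearMap.comp_zero, map_zero]
  map_add' f g := by
    rw [LinearMap.restrictScalars_add, LinearMap.add_comp, LinearMap.comp_add, map_add]

theorem of_toLin'_endToMatrix {n : ℕ} (A : Matrix (Fin n) (Fin n) F)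
    (f : Module.End F[X] (Module.AEval' (Matrix.toLin' A))) (v : Fin n → F) :
    Module.AEval'.of (Matrix.toLin' A) (Matrix.toLin' (endToMatrix A f) v) =
      f (Module.AEval'.of (Matrix.toLin' A) v) := by
  change Module.AEval'.of (Matrix.toLin' A) (Matrix.toLin' (LinearMap.toMatrix' _) v) = _
  rw [Matrix.toLin'_toMatrix']
  simp

/-- The endomorphisms of the `F[X]`-module attached to `A` are the matrices commuting with `A`, so
that the frame of the endomorphism ring of two Jordan blocks describes the centralizer of `A`. -/
theorem exists_isTwoBlockModel {n : ℕ} {A : Matrix (Fin n) (Fin n) F} (hnil : IsNilpotent A)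
    (hreg : IsRegularMatrix 2 A) :
    ∃ (q e : ℕ) (E G H : Module.End F[X] (JordanBlock F (q + e) × JordanBlock F q))
      (ρ : Module.End F[X] (JordanBlock F (q + e) × JordanBlock F q) →+*
        Matrix (Fin n) (Fin n) F), IsTwoBlockModel A q e E G H ρ := by
  obtain ⟨q, e, ⟨φ⟩⟩ := exists_aeval_linearEquiv hnil hreg
  obtain ⟨E, G, H, hK⟩ := exists_isTwoBlockFrame (F := F) q e
  have hinj : Function.Injective (endToMatrix A) := by
    intro f g h
    refine LinearMap.ext fun v => ?_
    obtain ⟨v, rfl⟩ := (Module.AEval'.of (Matrix.toLin' A)).surjective v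
    rw [← of_toLin'_endToMatrix, ← of_toLin'_endToMatrix, h]
  refine ⟨q, e, E, G, H, (endToMatrix A).comp φ.symm.conjRingEquiv.toRingHom,
    { toIsTwoBlockFrame := hK, injective := ?_, map_smul := ?_, exists_eq_of_commute := ?_,
      size_eq := ?_ }⟩
  · exact hinj.comp φ.symm.conjRingEquiv.injective
  · intro p x
    rw [← Matrix.toLin'.injective.eq_iff]
    refine LinearMap.ext fun v => (Module.AEval'.of (Matrix.toLin' A)).injective ?_
    have haeval : ∀ w, Module.AEval'.of (Matrix.toLin' A) (Matrix.toLin' (aeval A p) w) =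
        p • Module.AEval'.of (Matrix.toLin' A) w := by
      intro w
      rw [← Module.AEval.of_aeval_smul]
      congr 1
      have h1 := aeval_algHom_apply (Matrix.toLinAlgEquiv' : Matrix (Fin n) (Fin n) F ≃ₐ[F] _) A p
      exact (LinearMap.congr_fun h1 w).symm
    rw [Matrix.toLin'_mul, LinearMap.comp_apply, haeval]
    change Module.AEval'.of _ (Matrix.toLin' (endToMatrix A _) v) =
      p • Module.AEval'.of _ (Matrix.toLin' (endToMatrix A _) v)
    rw [of_toLin'_endToMatrix, of_toLin'_endToMatrix]
    change φ.symm ((p • x) _) = p • φ.symm (x _)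
    rw [LinearMap.smul_apply, map_smul]
  · intro B hB
    let g : Module.End F[X] (Module.AEval' (Matrix.toLin' A)) :=
      LinearMap.ofAEval _ ((Module.AEval'.of (Matrix.toLin' A)).toLinearMap ∘ₗ Matrix.toLin' B)
        fun v => by
          change Module.AEval'.of _ (Matrix.toLin' B (Matrix.toLin' A v)) =
            X • Module.AEval'.of _ (Matrix.toLin' B v)
          rw [Module.AEval'.X_smul_of, ← LinearMap.comp_apply, ← LinearMap.comp_apply,
            ← Matrix.toLin'_mul, ← Matrix.toLin'_mul, hB.eq]
    refine ⟨φ.symm.conjRingEquiv.symm g, ?_⟩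
    change B = endToMatrix A (φ.symm.conjRingEquiv (φ.symm.conjRingEquiv.symm g))
    rw [RingEquiv.apply_symm_apply, ← Matrix.toLin'.injective.eq_iff]
    refine LinearMap.ext fun v => (Module.AEval'.of (Matrix.toLin' A)).injective ?_
    rw [of_toLin'_endToMatrix]
    simp [g, LinearMap.ofAEval]
  · have h1 := ((Module.AEval'.of (Matrix.toLin' A)).trans (φ.restrictScalars F)).finrank_eq
    rw [Module.finrank_fin_fun, Module.finrank_prod, JordanBlock.finrank_eq,
      JordanBlock.finrank_eq] at h1
    exact h1.symm

end Structure

theorem mainTheorem3 {F : Type*} [Field F] [IsAlgClosed F] (n : ℕ)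
    (A : Matrix (Fin n) (Fin n) F) (hnil : IsNilpotent A) (hreg : IsRegularMatrix 2 A) :
    @IsIrreducible _ (pairZariski F n) (nilpotentPairs A) ∧
      nilpotentPairs A = @closure _ (pairZariski F n) (fullPairs A) := by
  let _ := pairZariski F n
  obtain ⟨q, e, E, G, H, ρ, hM⟩ := exists_isTwoBlockModel hnil hreg
  refine ⟨⟨⟨(0, 0), ?_⟩, hM.isPreirreducible_nilpotentPairs⟩, Set.Subset.antisymm ?_ ?_⟩
  · exact ⟨⟨Commute.zero_right _, Commute.zero_right _, Commute.zero_right _⟩,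
      IsNilpotent.zero, IsNilpotent.zero⟩
  · exact hM.nilpotentPairs_subset_closure.trans (closure_mono hM.unimodularPairs_subset_fullPairs)
  · exact closure_minimal (fun P hP => hP.1) (isClosed_nilpotentPairs A)
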